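/- Let $f$ be a holomorphic Hecke cusp form of weight $k\ge 12$ for $SL_2(\mathbb Z)$ (a nonzero cusp form that is an eigenfunction of every Hecke operator $T_n$, $n\ge 1$; then $k$ is even), with Hecke eigenvalues $\lambda_f(n)$ normalized by $T_nf=n^{\frac{k-1}{2}}\lambda_f(n)f$, where $$(T_nf)(z)=n^{k-1}\sum_{d\mid n}d^{-k}\sum_{b=0}^{d-1}f\Big(\frac{(n/d)z+b}{d}\Big).$$ Write $e(x)=e^{2\pi i x}$. For $\alpha\in\mathbb Q$ and a Dirichlet character $\chi$ let $$L(s,f)=\sum_{n\ge1}\frac{\lambda_f(n)}{n^s},\qquad L(s,f\otimes e(\alpha))=\sum_{n\ge1}\frac{\lambda_f(n)e(n\alpha)}{n^s},\qquad L(s,f\otimes\chi)=\sum_{n\ge1}\frac{\lambda_f(n)\chi(n)}{n^s}$$ for $\Re(s)>1$, and by analytic continuation elsewhere. For an odd prime $q$ and an integer $a$ put $$M_f(a,q)=\frac1{\phi(q)}\Big(\ \sideset{}{^*}\sum_{\chi\,(\mathrm{mod}\ q)}\tau(\chi)\,L\big(\tfrac12,f\otimes\overline\chi\big)\,\chi(a)+\big(\lambda_f(q)q^{\frac12}-2\big)L\big(\tfrac12,f\big)\Big),$$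 where $\sum^*$ runs over the primitive Dirichlet characters modulo $q$, $\tau(\chi)=\sum_{n\,(\mathrm{mod}\ q)}\chi(n)e(n/q)$ and $\phi$ is Euler's function. Let $p,q$ be distinct odd primes. The series $L(s,f)$, $L(s,f\otimes e(\alpha))$ for every $\alpha\in\mathbb Q$, and $L(s,f\otimes\chi)$ for every primitive character $\chi$ modulo $p$ or $q$ converge absolutely for $\Re(s)>1$ and continue to entire functions of $s$, and $$M_f(p,q)-M_f(-q,p)=L\big(\tfrac12,f\big)+\sum_{j=1}^{\frac k2-1}\frac1{j!}\,\frac{\Gamma(\frac k2+j)}{\Gamma(\frac k2-j)}\Big(\frac{2\pi i q}{p}\Big)^{-j}\Big(L\big(\tfrac12+j,f\big)+(-1)^j i^k\,L\big(\tfrac12+j,f\otimes e(\tfrac qp)\big)\Big).$$ -/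

import Mathlib

open scoped MatrixGroups UpperHalfPlane

noncomputable section

namespace HeckeReciprocity

/-- The classical Hecke operator `T_n` in weight `k` and level one, for `n ≥ 1`:
`(T_n f)(z) = n^(k-1) ∑_{d ∣ n} d^(-k) ∑_{b mod d} f (((n/d) z + b) / d)`.
(All points at which `f` is evaluated lie in the upper half-plane, so that
`UpperHalfPlane.ofComplex` only repackages them.) -/
def heckeOperator (k : ℤ) (n : ℕ) (f : ℍ → ℂ) : ℍ → ℂ := fun z =>
  (n : ℂ) ^ (k - 1) * ∑ d ∈ n.divisors, (d : ℂ) ^ (-k) *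
    ∑ b ∈ Finset.range d,
      f (UpperHalfPlane.ofComplex ((((n / d : ℕ) : ℂ) * (z : ℂ) + (b : ℂ)) / (d : ℂ)))

/-- `c` is the normalized eigenvalue of `T_n` on `f`, that is, `T_n f = n^((k-1)/2) c f`. -/
def IsNormalizedEigenvalue {k : ℤ} (f : CuspForm 𝒮ℒ k) (n : ℕ) (c : ℂ) : Prop :=
  ∀ z : ℍ, heckeOperator k n f z = (n : ℂ) ^ (((k : ℂ) - 1) / 2) * c * f z

/-- A Hecke cusp form for `SL₂(ℤ)`: a nonzero cusp form which is an eigenfunction of all Hecke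
operators `T_n`, `n ≥ 1`. -/
def IsHeckeCuspForm {k : ℤ} (f : CuspForm 𝒮ℒ k) : Prop :=
  f ≠ 0 ∧ ∀ n : ℕ, 1 ≤ n → ∃ c : ℂ, IsNormalizedEigenvalue f n c

open Classical in
/-- The normalized Hecke eigenvalue `λ_f(n)`. -/
def heckeEigenvalue {k : ℤ} (f : CuspForm 𝒮ℒ k) (n : ℕ) : ℂ :=
  if h : ∃ c : ℂ, IsNormalizedEigenvalue f n c then h.choose else 0

/-- `F` is the entire continuation of the Dirichlet series `∑_{n ≥ 1} a(n) n^(-s)`, which is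
required to converge absolutely, with sum `F s`, for `Re s > 1`. -/
def IsEntireContinuation (a : ℕ → ℂ) (F : ℂ → ℂ) : Prop :=
  Differentiable ℂ F ∧ ∀ s : ℂ, 1 < s.re → LSeriesHasSum a s (F s)

/-- An entire continuation is unique. -/
theorem IsEntireContinuation.unique {a : ℕ → ℂ} {F G : ℂ → ℂ}
    (hF : IsEntireContinuation a F) (hG : IsEntireContinuation a G) : F = G := by
  refine AnalyticOnNhd.eq_of_eventuallyEq (z₀ := 2)
    (fun z _ => hF.1.analyticAt z) (fun z _ => hG.1.analyticAt z) ?_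
  have h : {s : ℂ | 1 < s.re} ∈ nhds (2 : ℂ) :=
    (isOpen_lt continuous_const Complex.continuous_re).mem_nhds (by simp)
  filter_upwards [h] with s hs
  exact (hF.2 s hs).unique (hG.2 s hs)

open Classical in
/-- The value at `s` of the entire continuation of `∑_{n ≥ 1} a(n) n^(-s)`
(and `0` if there is no entire continuation). -/
def continuedLSeries (a : ℕ → ℂ) (s : ℂ) : ℂ :=
  if h : ∃ F : ℂ → ℂ, IsEntireContinuation a F then h.choose s else 0

/-- The coefficients `λ_f(n) χ(n)` of `L(s, f ⊗ χ)`. -/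
def charTwist {k : ℤ} (f : CuspForm 𝒮ℒ k) {N : ℕ} (χ : DirichletCharacter ℂ N) (n : ℕ) : ℂ :=
  heckeEigenvalue f n * χ (n : ZMod N)

/-- The coefficients `λ_f(n) e(n α)` of `L(s, f ⊗ e(α))`, where `e(x) = exp(2 π i x)`. -/
def addTwist {k : ℤ} (f : CuspForm 𝒮ℒ k) (α : ℚ) (n : ℕ) : ℂ :=
  heckeEigenvalue f n * Complex.exp (2 * (Real.pi : ℂ) * Complex.I * ((n : ℂ) * (α : ℂ)))

/-- `L(s, f)`. -/
def L {k : ℤ} (f : CuspForm 𝒮ℒ k) (s : ℂ) : ℂ := continuedLSeries (heckeEigenvalue f) s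

/-- `L(s, f ⊗ χ)`. -/
def LChar {k : ℤ} (f : CuspForm 𝒮ℒ k) {N : ℕ} (χ : DirichletCharacter ℂ N) (s : ℂ) : ℂ :=
  continuedLSeries (charTwist f χ) s

/-- `L(s, f ⊗ e(α))`. -/
def LAdd {k : ℤ} (f : CuspForm 𝒮ℒ k) (α : ℚ) (s : ℂ) : ℂ := continuedLSeries (addTwist f α) s

/-- The Gauss sum `τ(χ) = ∑_{n mod q} χ(n) e(n/q)`. -/
def tau {q : ℕ} [NeZero q] (χ : DirichletCharacter ℂ q) : ℂ := gaussSum χ ZMod.stdAddChar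

open Classical in
/-- The twisted moment
`M_f(a, q) = φ(q)⁻¹ (∑* τ(χ) L(1/2, f ⊗ χ̄) χ(a) + (λ_f(q) q^(1/2) - 2) L(1/2, f))`,
where the sum is over the primitive characters `χ` modulo `q`; here `χ⁻¹` is the complex
conjugate character `χ̄`. -/
def twistedMoment {k : ℤ} (f : CuspForm 𝒮ℒ k) (a : ℤ) (q : ℕ) [NeZero q] : ℂ :=
  1 / (Nat.totient q : ℂ) *
    ((∑ χ : DirichletCharacter ℂ q with χ.IsPrimitive,
        tau χ * LChar f χ⁻¹ (1 / 2) * χ (a : ZMod q))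
      + (heckeEigenvalue f q * (Real.sqrt (q : ℝ) : ℂ) - 2) * L f (1 / 2))

end HeckeReciprocity

end

open scoped MatrixGroups UpperHalfPlane
open UpperHalfPlane hiding I
open Complex Filter Topology Set Asymptotics MeasureTheory

namespace HeckeReciprocity

/-! ### Cusp forms on the complex upper half-plane: Fourier expansion, modularity, bounds -/

section

/-! Gauss sums and orthogonality of characters turn the moment M_f(a,q) into one additive twist
L(1/2, f⊗e(a'/q)), where aa' ≡ 1 mod q. The correction (λ_f(q)√q − 2)L(1/2,f) is exactly the
contribution of the principal character, by the Hecke relation at q (`twistedMoment_eq_LAdd`). With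
pu + qv = 1, the left-hand side is therefore L(1/2, f⊗e(u/q)) − L(1/2, f⊗e(−v/p)).

Put m = k/2 − 1. Up to explicit constants, L(1/2+j, f⊗e(x)) is the integral of f(z)(z−x)^(m+j) dz
from x to i∞. For deg P ≤ k−2, the pullback of f P dz under SL₂(ℤ) has the same shape, and its
integrals depend only on the end cusps. The matrix γ = (q, −u; p, v) sends u/q to 0 and ∞ to q/p, so
the central integral at u/q becomes the integral of f(z) z^m (1−pz/q)^m from 0 to q/p. Splitting it
at i∞ and expanding binomially gives the values at 1/2+j (`mellin_three_term`). In the j = 0 term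
the central value at q/p remains. Since γ sends −v/p to ∞ and ∞ to q/p, a functional equation
exchanges it for the central value at −v/p (`mellin_two_term`). `LAdd_sub_LAdd` combines the two
relations.

The continuations come from rapid decay of f at every cusp, and absolute convergence for Re s > 1
from a mean-square bound on the coefficients. -/

/-- A cusp form as a function of a complex variable (meaningful on the upper half plane). -/
noncomputable def lift {k : ℕ} (f : CuspForm 𝒮ℒ (k : ℤ)) (z : ℂ) : ℂ := f (ofComplex z)

/-- The Fourier coefficients of a cusp form of level one. -/
noncomputable def fourierCoefficient {k : ℕ} (f : CuspForm 𝒮ℒ (k : ℤ)) (n : ℕ) : ℂ :=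
  (qExpansion 1 f).coeff n

section basics

variable {k : ℕ} (f : CuspForm 𝒮ℒ (k : ℤ))

lemma lift_coe (z : ℍ) : lift f z = f z := by
  simp [lift, ofComplex_apply]

lemma differentiableAt_lift {z : ℂ} (hz : 0 < z.im) : DifferentiableAt ℂ (lift f) z :=
  mdifferentiableAt_iff_differentiableAt.mp
    ((CuspFormClass.holo f _).comp z (mdifferentiableAt_ofComplex hz))

lemma hasSum_lift {z : ℂ} (hz : 0 < z.im) :
    HasSum (fun n : ℕ ↦ fourierCoefficient f n * exp (2 * Real.pi * I * n * z)) (lift f z) := by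
  have h := ModularForm.hasSum_qExpansion f one_pos one_mem_strictPeriods_SL ⟨z, hz⟩
  convert! h using 1
  · funext n
    rw [fourierCoefficient, Function.Periodic.qParam, ← exp_nat_mul]
    congr 2
    push_cast
    ring
  · rw [← lift_coe]

lemma fourierCoefficient_zero : fourierCoefficient f 0 = 0 :=
  CuspFormClass.qExpansion_coeff_zero f one_pos one_mem_strictPeriods_SL

lemma fourierCoefficient_unique {f : CuspForm 𝒮ℒ (k : ℤ)} {c : ℕ → ℂ}
    (h : ∀ z : ℍ, HasSum (fun n ↦ c n * exp (2 * Real.pi * I * n * z)) (f z)) (n : ℕ) :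
    c n = fourierCoefficient f n := by
  refine ModularFormClass.qExpansion_coeff_unique (f := f) one_pos one_mem_strictPeriods_SL
    (fun z ↦ ?_) n
  convert! h z using 2 with n
  rw [smul_eq_mul, Function.Periodic.qParam, ← exp_nat_mul]
  congr 2
  push_cast
  ring

lemma im_mobius_pos {a b c d : ℤ} (h : a * d - b * c = 1) {z : ℂ} (hz : 0 < z.im) :
    (c : ℂ) * z + d ≠ 0 ∧ 0 < (((a : ℂ) * z + b) / (c * z + d)).im ∧
      (((a : ℂ) * z + b) / (c * z + d)).im = z.im / normSq (c * z + d) := by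
  have h0 : (c : ℂ) * z + d ≠ 0 := by
    intro h0
    have h1 := congrArg Complex.im h0
    have h2 := congrArg Complex.re h0
    simp at h1 h2
    rcases h1 with h1 | h1
    · subst h1
      simp at h2
      subst h2
      simp at h
    · exact hz.ne' h1
  have hR : (a : ℝ) * d - b * c = 1 := mod_cast h
  have him : (((a : ℂ) * z + b) / (c * z + d)).im = z.im / normSq (c * z + d) := by
    have hn : normSq ((c : ℂ) * z + d) ≠ 0 := by simpa [normSq_eq_zero] using h0
    rw [div_im, ← sub_div, div_left_inj' hn]
    simp
    linear_combination z.im * hR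
  exact ⟨h0, him ▸ div_pos hz (normSq_pos.mpr h0), him⟩

lemma lift_mobius {a b c d : ℤ} (h : a * d - b * c = 1) {z : ℂ} (hz : 0 < z.im) :
    lift f ((a * z + b) / (c * z + d)) = (c * z + d) ^ k * lift f z := by
  let γ : SL(2, ℤ) := ⟨!![a, b; c, d], by rw [Matrix.det_fin_two_of]; exact h⟩
  have h1 := SlashInvariantForm.slash_action_eqn'' f (γ := Matrix.SpecialLinearGroup.mapGL ℝ γ)
    (MonoidHom.mem_range.mpr ⟨γ, rfl⟩) ⟨z, hz⟩
  have h2 : ((a * z + b) / (c * z + d) : ℂ) = ((γ • (⟨z, hz⟩ : ℍ) : ℍ) : ℂ) := by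
    rw [UpperHalfPlane.coe_specialLinearGroup_apply]
    simp [γ]
  rw [h2, lift_coe]
  have h3 : lift f z = f ⟨z, hz⟩ := lift_coe f ⟨z, hz⟩
  rw [h3]
  refine Eq.trans ?_ (h1.trans ?_)
  · rfl
  · have hden : denom (Matrix.SpecialLinearGroup.mapGL ℝ γ) z = ((c : ℝ) : ℂ) * z + ((d : ℝ) : ℂ) :=
      rfl
    rw [hden]
    norm_cast

lemma lift_decay : ∃ A C : ℝ, 0 < A ∧ 0 < C ∧ ∀ z : ℂ, A ≤ z.im →
    ‖lift f z‖ ≤ C * Real.exp (-2 * Real.pi * z.im) := by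
  obtain ⟨C, hC, h⟩ := (CuspFormClass.exp_decay_atImInfty f one_pos
    one_mem_strictPeriods_SL).exists_pos
  rw [IsBigOWith, atImInfty, eventually_comap, eventually_atTop] at h
  obtain ⟨A, hA⟩ := h
  refine ⟨max A 1, C, by positivity, hC, fun z hz ↦ ?_⟩
  have hz0 : 0 < z.im := by linarith [le_max_right A 1]
  have := hA z.im (le_trans (le_max_left _ _) hz) ⟨z, hz0⟩ rfl
  rw [← lift_coe] at this
  simpa using this

lemma lift_bound : ∃ C : ℝ, 0 < C ∧ ∀ z : ℂ, 0 < z.im →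
    ‖lift f z‖ ≤ C / z.im ^ (k / 2 : ℝ) := by
  obtain ⟨C, hC⟩ := CuspFormClass.exists_bound f
  refine ⟨max C 1, by positivity, fun z hz ↦ ?_⟩
  have := hC ⟨z, hz⟩
  rw [← lift_coe] at this
  refine this.trans ?_
  simp only [Int.cast_natCast, UpperHalfPlane.im]
  gcongr
  exact le_max_left _ _

lemma even_weight (hf : f ≠ 0) : Even k := by
  by_contra hk
  rw [Nat.not_even_iff_odd] at hk
  apply hf
  ext z
  have h := lift_mobius f (a := -1) (b := 0) (c := 0) (d := -1) (by norm_num) z.im_pos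
  simp [hk.neg_one_pow, lift_coe] at h
  have h2 : (2 : ℂ) * f z = 0 := by linear_combination h
  simpa using h2

end basics

end

/-! ### Hecke operators on Fourier coefficients and the Hecke relations at primes -/

section

lemma sum_exp_div (d m : ℕ) (hd : 0 < d) :
    ∑ b ∈ Finset.range d, exp (2 * Real.pi * I * m * (b / d)) = if d ∣ m then (d : ℂ) else 0 := by
  have hd' : (d : ℂ) ≠ 0 := by exact_mod_cast hd.ne'
  set ζ := exp (2 * Real.pi * I * m / d) with hζ
  have h1 (b : ℕ) : exp (2 * Real.pi * I * m * (b / d)) = ζ ^ b := by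
    rw [hζ, ← exp_nat_mul]
    congr 1
    ring
  have h2 : ζ ^ d = 1 := by
    rw [hζ, ← exp_nat_mul, exp_eq_one_iff]
    exact ⟨m, by push_cast; field_simp⟩
  simp_rw [h1]
  split_ifs with h
  · obtain ⟨r, rfl⟩ := h
    have : ζ = 1 := by
      rw [hζ, exp_eq_one_iff]
      exact ⟨r, by push_cast; field_simp⟩
    simp [this]
  · have : ζ ≠ 1 := by
      intro h3
      rw [hζ, exp_eq_one_iff] at h3
      obtain ⟨r, hr⟩ := h3
      apply h
      have h4 : (m : ℂ) = d * r := by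
        have hpi : (2 * Real.pi * I : ℂ) ≠ 0 := two_pi_I_ne_zero
        field_simp at hr
        linear_combination hr
      have h5 : (m : ℤ) = d * r := by exact_mod_cast h4
      exact Int.natCast_dvd_natCast.mp ⟨r, h5⟩
    rw [geom_sum_eq this, h2, sub_self, zero_div]

variable {k : ℕ} (f : CuspForm 𝒮ℒ (k : ℤ))

/-- The sum over b keeps only the frequencies m = dr, and these become l = er in the variable z.
Hence the two reindexings. -/
lemma hasSum_sum_lift (d e : ℕ) (hd : 0 < d) (he : 0 < e) {z : ℂ} (hz : 0 < z.im) :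
    HasSum (fun l : ℕ ↦ (if e ∣ l then d * fourierCoefficient f (d * (l / e)) else 0) *
        exp (2 * Real.pi * I * l * z))
      (∑ b ∈ Finset.range d, lift f ((e * z + b) / d)) := by
  have hd' : (d : ℂ) ≠ 0 := by exact_mod_cast hd.ne'
  have him (b : ℕ) : 0 < ((e * z + b) / d : ℂ).im := by
    have : ((e * z + b) / d : ℂ) = ((d : ℝ)⁻¹ : ℝ) * (((e : ℝ) : ℂ) * z + ((b : ℝ) : ℂ)) := by
      push_cast
      field_simp
    rw [this, im_ofReal_mul, add_im, im_ofReal_mul, ofReal_im, add_zero]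
    positivity
  have h1 : HasSum (fun m : ℕ ↦ ∑ b ∈ Finset.range d, fourierCoefficient f m *
      exp (2 * Real.pi * I * m * ((e * z + b) / d)))
      (∑ b ∈ Finset.range d, lift f ((e * z + b) / d)) :=
    hasSum_sum fun b _ ↦ hasSum_lift f (him b)
  have h2 (m : ℕ) : ∑ b ∈ Finset.range d, fourierCoefficient f m *
      exp (2 * Real.pi * I * m * ((e * z + b) / d)) =
      fourierCoefficient f m * exp (2 * Real.pi * I * m * (e * z / d)) *
        if d ∣ m then (d : ℂ) else 0 := by
    rw [← sum_exp_div d m hd, Finset.mul_sum]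
    refine Finset.sum_congr rfl fun b _ ↦ ?_
    rw [mul_assoc (fourierCoefficient f m), ← exp_add]
    congr 2
    ring
  simp_rw [h2] at h1
  have h3 := (Function.Injective.hasSum_iff (g := fun m : ℕ ↦ d * m)
    (fun x y h ↦ Nat.eq_of_mul_eq_mul_left hd h) (fun m hm ↦ by
      rw [if_neg, mul_zero]
      rintro ⟨r, rfl⟩
      exact hm ⟨r, rfl⟩)).mpr h1
  refine (Function.Injective.hasSum_iff (g := fun m : ℕ ↦ e * m)
    (fun x y h ↦ Nat.eq_of_mul_eq_mul_left he h) (fun m hm ↦ by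
      rw [if_neg, zero_mul]
      rintro ⟨r, rfl⟩
      exact hm ⟨r, rfl⟩)).mp ?_
  convert! h3 using 1
  funext m
  simp only [Function.comp, dvd_mul_right, if_true, Nat.mul_div_cancel_left m he]
  have : (2 * Real.pi * I * ((d * m : ℕ) : ℂ) * (e * z / d) : ℂ) =
      2 * Real.pi * I * ((e * m : ℕ) : ℂ) * z := by
    push_cast
    field_simp
  rw [this]
  ring

/-- The Fourier coefficients of `T_n f`. -/
noncomputable def heckeCoefficient (n l : ℕ) : ℂ :=
  (n : ℂ) ^ ((k : ℤ) - 1) * ∑ d ∈ n.divisors, (d : ℂ) ^ (-(k : ℤ)) *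
    if n / d ∣ l then d * fourierCoefficient f (d * (l / (n / d))) else 0

lemma hasSum_heckeOperator (n : ℕ) (z : ℍ) :
    HasSum (fun l : ℕ ↦ heckeCoefficient f n l * exp (2 * Real.pi * I * l * z))
      (heckeOperator k n f z) := by
  simp only [heckeCoefficient, heckeOperator, mul_assoc _ (Finset.sum _ _), Finset.sum_mul]
  refine HasSum.mul_left _ (hasSum_sum fun d hd ↦ ?_)
  have hd' := Nat.pos_of_mem_divisors hd
  have h := hasSum_sum_lift f d (n / d) hd'
    (Nat.div_pos (Nat.divisor_le hd) hd') z.im_pos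
  convert! h.mul_left ((d : ℂ) ^ (-(k : ℤ))) using 2
  ring

lemma heckeCoefficient_eq {n : ℕ} {c : ℂ} (h : IsNormalizedEigenvalue f n c) (l : ℕ) :
    heckeCoefficient f n l = (n : ℂ) ^ (((k : ℂ) - 1) / 2) * c * fourierCoefficient f l := by
  have h1 (z : ℍ) := hasSum_heckeOperator f n z
  simp only [h _, Int.cast_natCast] at h1
  have h2 := fun l ↦ fourierCoefficient_unique
    (f := ((n : ℂ) ^ (((k : ℂ) - 1) / 2) * c) • f) h1 l
  have h3 := fun l ↦ fourierCoefficient_unique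
    (f := ((n : ℂ) ^ (((k : ℂ) - 1) / 2) * c) • f)
    (c := fun l ↦ (n : ℂ) ^ (((k : ℂ) - 1) / 2) * c * fourierCoefficient f l) (fun z ↦ by
      have := (hasSum_lift f z.im_pos).mul_left ((n : ℂ) ^ (((k : ℂ) - 1) / 2) * c)
      simp only [lift_coe, ← mul_assoc] at this ⊢
      exact this) l
  rw [h2, h3]

/-- Only d = n survives, since n/d must divide 1. The eigenvalue equation at the first coefficient
thus determines every coefficient from the first. -/
lemma heckeCoefficient_one {n : ℕ} (hn : 1 ≤ n) :
    heckeCoefficient f n 1 = fourierCoefficient f n := by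
  have hn' : (n : ℂ) ≠ 0 := by exact_mod_cast (by omega : n ≠ 0)
  rw [heckeCoefficient, Finset.sum_eq_single n]
  · rw [Nat.div_self hn, if_pos (dvd_refl 1), zpow_sub_one₀ hn', zpow_neg]
    field_simp
    simp
  · intro d hd hdn
    rw [if_neg, mul_zero]
    intro h
    have h1 : n / d = 1 := Nat.dvd_one.mp h
    exact hdn (by simpa [h1] using Nat.mul_div_cancel' (Nat.dvd_of_mem_divisors hd))
  · simp
    omega

lemma heckeCoefficient_prime {q : ℕ} (hq : q.Prime) (l : ℕ) :
    heckeCoefficient f q l = fourierCoefficient f (q * l) +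
      if q ∣ l then (q : ℂ) ^ ((k : ℤ) - 1) * fourierCoefficient f (l / q) else 0 := by
  have hq' : (q : ℂ) ≠ 0 := by exact_mod_cast hq.ne_zero
  rw [heckeCoefficient, hq.divisors, Finset.sum_pair hq.one_lt.ne, Nat.div_one,
    Nat.div_self hq.pos, if_pos (one_dvd _), Nat.div_one, mul_add, add_comm]
  congr 1
  · rw [zpow_sub_one₀ hq', zpow_neg]
    field_simp
  · simp

section eigenform

variable {f} (hf : IsHeckeCuspForm f)
include hf

lemma isNormalizedEigenvalue_heckeEigenvalue {n : ℕ} (hn : 1 ≤ n) :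
    IsNormalizedEigenvalue f n (heckeEigenvalue f n) := by
  have h := hf.2 n hn
  rw [heckeEigenvalue, dif_pos h]
  exact h.choose_spec

lemma fourierCoefficient_eq {n : ℕ} (hn : 1 ≤ n) :
    fourierCoefficient f n =
      (n : ℂ) ^ (((k : ℂ) - 1) / 2) * heckeEigenvalue f n * fourierCoefficient f 1 := by
  rw [← heckeCoefficient_one f hn,
    heckeCoefficient_eq f (isNormalizedEigenvalue_heckeEigenvalue hf hn)]

lemma fourierCoefficient_one_ne_zero : fourierCoefficient f 1 ≠ 0 := by
  intro h
  apply hf.1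
  have h0 (n : ℕ) : fourierCoefficient f n = 0 := by
    rcases Nat.eq_zero_or_pos n with rfl | hn
    · exact fourierCoefficient_zero f
    · rw [fourierCoefficient_eq hf hn, h, mul_zero]
  ext z
  have h1 := hasSum_lift f z.im_pos
  simp only [h0, zero_mul] at h1
  have h2 := h1.unique hasSum_zero
  exact (lift_coe f z).symm.trans h2

/-- Compare the l-th coefficients of T_q f. The factor q^(k−1) is the square of q^((k−1)/2), so the
normalization removes it. -/
lemma heckeEigenvalue_mul_prime {q : ℕ} (hq : q.Prime) {l : ℕ} (hl : 1 ≤ l) :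
    heckeEigenvalue f (q * l) = heckeEigenvalue f q * heckeEigenvalue f l -
      if q ∣ l then heckeEigenvalue f (l / q) else 0 := by
  have ha := fourierCoefficient_one_ne_zero hf
  have hq' : (q : ℂ) ≠ 0 := by exact_mod_cast hq.ne_zero
  have hl' : (l : ℂ) ≠ 0 := by exact_mod_cast (by omega : l ≠ 0)
  have hpq : (q : ℂ) ^ (((k : ℂ) - 1) / 2) ≠ 0 := by simp [cpow_eq_zero_iff, hq']
  have hpl : (l : ℂ) ^ (((k : ℂ) - 1) / 2) ≠ 0 := by simp [cpow_eq_zero_iff, hl']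
  have h := heckeCoefficient_eq f (isNormalizedEigenvalue_heckeEigenvalue hf hq.one_le) l
  have hmul : ((q * l : ℕ) : ℂ) ^ (((k : ℂ) - 1) / 2) =
      (q : ℂ) ^ (((k : ℂ) - 1) / 2) * (l : ℂ) ^ (((k : ℂ) - 1) / 2) :=
    natCast_mul_natCast_cpow q l _ ▸ by push_cast; rfl
  rw [heckeCoefficient_prime f hq, fourierCoefficient_eq hf hl,
    fourierCoefficient_eq hf (Nat.mul_pos hq.pos hl : 1 ≤ q * l), hmul] at h
  split_ifs with hd
  · obtain ⟨r, rfl⟩ := hd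
    have hr : 1 ≤ r := Nat.pos_of_mul_pos_left hl
    rw [if_pos (dvd_mul_right q r), Nat.mul_div_cancel_left r hq.pos,
      fourierCoefficient_eq hf hr] at h
    rw [Nat.mul_div_cancel_left r hq.pos]
    have hmul' : ((q * r : ℕ) : ℂ) ^ (((k : ℂ) - 1) / 2) =
        (q : ℂ) ^ (((k : ℂ) - 1) / 2) * (r : ℂ) ^ (((k : ℂ) - 1) / 2) :=
      natCast_mul_natCast_cpow q r _ ▸ by push_cast; rfl
    have hz : (q : ℂ) ^ ((k : ℤ) - 1) =
        (q : ℂ) ^ (((k : ℂ) - 1) / 2) * (q : ℂ) ^ (((k : ℂ) - 1) / 2) := by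
      rw [← cpow_add _ _ hq', ← cpow_intCast]
      congr 1
      push_cast
      ring
    rw [hz, hmul'] at h
    rw [hmul'] at hpl
    have := mul_ne_zero (mul_ne_zero hpq hpl) ha
    apply mul_left_cancel₀ this
    linear_combination h
  · rw [if_neg hd] at h
    have := mul_ne_zero (mul_ne_zero hpq hpl) ha
    apply mul_left_cancel₀ this
    linear_combination h

end eigenform

end

/-! ### Mean-square bound and absolute convergence -/

section

variable {k : ℕ} (f : CuspForm 𝒮ℒ (k : ℤ))

lemma continuous_lift_horizontal {y : ℝ} (hy : 0 < y) :
    Continuous fun x : ℝ ↦ lift f (x + y * I) := by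
  refine continuous_iff_continuousAt.mpr fun x ↦ ?_
  exact ContinuousAt.comp (f := fun x : ℝ ↦ (x + y * I : ℂ)) (g := lift f)
    (differentiableAt_lift f (by simpa using hy)).continuousAt (by fun_prop)

lemma fourierCoeffOn_lift {y : ℝ} (hy : 0 < y) (n : ℕ) :
    fourierCoeffOn (zero_lt_one' ℝ) (fun x : ℝ ↦ lift f (x + y * I)) (n : ℤ) =
      fourierCoefficient f n * exp (-(2 * Real.pi * n * y)) := by
  rw [fourierCoeffOn_eq_integral, fourierCoefficient,
    ModularFormClass.qExpansion_coeff_eq_intervalIntegral f one_pos one_mem_strictPeriods_SL n hy,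
    mul_assoc, ← intervalIntegral.integral_mul_const]
  simp only [sub_zero, div_one, one_smul, ofReal_one, one_mul]
  refine intervalIntegral.integral_congr fun x _ ↦ ?_
  have h1 : lift f (x + y * I) = f ⟨x + y * I, by simpa using hy⟩ :=
    lift_coe f ⟨x + y * I, by simpa using hy⟩
  have h2 : fourier (T := (1 - 0 : ℝ)) (-(n : ℤ)) (x : AddCircle (1 - 0 : ℝ)) =
      1 / Function.Periodic.qParam 1 (x + y * I) ^ n * exp (-(2 * Real.pi * n * y)) := by
    rw [fourier_coe_apply, Function.Periodic.qParam, ← exp_nat_mul, one_div, ← exp_neg, ← exp_add]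
    congr 1
    push_cast
    linear_combination 2 * Real.pi * n * y * I_sq
  simp only [smul_eq_mul]
  rw [h1, h2]
  ring

/-- Parseval on the segment at height y, with all but finitely many frequencies dropped by
positivity. -/
lemma sum_sq_fourierCoefficient_le {C : ℝ} (hC : ∀ z : ℂ, 0 < z.im →
    ‖lift f z‖ ≤ C / z.im ^ (k / 2 : ℝ)) {y : ℝ} (hy : 0 < y) (s : Finset ℕ) :
    ∑ n ∈ s, (‖fourierCoefficient f n‖ * Real.exp (-(2 * Real.pi * n * y))) ^ 2 ≤
      C ^ 2 / y ^ k := by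
  have hcont := continuous_lift_horizontal f hy
  have hL : MemLp (fun x : ℝ ↦ lift f (x + y * I)) 2 (volume.restrict (Ioc 0 1)) := by
    refine MemLp.of_bound hcont.aestronglyMeasurable (C / y ^ (k / 2 : ℝ))
      (Eventually.of_forall fun x ↦ ?_)
    simpa using hC (x + y * I) (by simpa using hy)
  have h := hasSum_sq_fourierCoeffOn (zero_lt_one' ℝ) hL
  have h1 := sum_le_hasSum (s.map Nat.castEmbedding) (fun i _ ↦ by positivity) h
  rw [Finset.sum_map] at h1
  refine le_trans (le_of_eq ?_) (h1.trans ?_)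
  · refine Finset.sum_congr rfl fun n _ ↦ ?_
    rw [Nat.castEmbedding_apply, fourierCoeffOn_lift f hy, norm_mul, norm_exp]
    congr 3
    simp [← ofReal_natCast]
  · rw [sub_zero, inv_one, one_smul]
    have h2 : ∀ x : ℝ, ‖lift f (x + y * I)‖ ^ 2 ≤ C ^ 2 / y ^ k := fun x ↦ by
      have := hC (x + y * I) (by simpa using hy)
      have h3 : ((y ^ (k / 2 : ℝ)) ^ 2 : ℝ) = y ^ k := by
        rw [← Real.rpow_natCast, ← Real.rpow_natCast, ← Real.rpow_mul hy.le]
        congr 1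
        push_cast
        ring
      rw [← h3, ← div_pow]
      gcongr
      simpa using this
    calc ∫ x in (0 : ℝ)..1, ‖lift f (x + y * I)‖ ^ 2 ≤ ∫ x in (0 : ℝ)..1, C ^ 2 / y ^ k :=
          intervalIntegral.integral_mono zero_le_one
            ((hcont.norm.pow 2).intervalIntegrable _ _) (by simp) h2
      _ = _ := by simp

lemma isBigO_sum_sq_fourierCoefficient :
    (fun n ↦ ∑ m ∈ Finset.Icc 1 n, ‖((‖fourierCoefficient f m‖ ^ 2 : ℝ) : ℂ)‖) =O[atTop]
      fun n ↦ (n : ℝ) ^ (k : ℝ) := by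
  obtain ⟨C, -, hC⟩ := lift_bound f
  refine IsBigO.of_bound (C ^ 2 * Real.exp (4 * Real.pi)) ?_
  filter_upwards [eventually_gt_atTop 0] with n hn
  have hn' : (0 : ℝ) < n := by exact_mod_cast hn
  -- At height 1/n each squared exponential factor with m ≤ n is at least e^(−4π).
  have h := sum_sq_fourierCoefficient_le f hC (y := 1 / n) (by positivity) (Finset.Icc 1 n)
  rw [Real.norm_of_nonneg (by positivity), Real.norm_of_nonneg (by positivity), Real.rpow_natCast]
  have h1 : ∑ m ∈ Finset.Icc 1 n, ‖fourierCoefficient f m‖ ^ 2 * Real.exp (-(4 * Real.pi)) ≤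
      C ^ 2 * n ^ k := by
    refine le_trans (Finset.sum_le_sum fun m hm ↦ ?_) (h.trans (le_of_eq ?_))
    · rw [mul_pow, ← Real.exp_nat_mul]
      gcongr
      have : (m : ℝ) ≤ n := by exact_mod_cast (Finset.mem_Icc.mp hm).2
      push_cast
      have h2 : (m : ℝ) * (1 / n) ≤ 1 := by
        rw [mul_one_div]
        exact (div_le_one hn').mpr this
      nlinarith [Real.pi_pos]
    · simp
  rw [← Finset.sum_mul, Real.exp_neg, mul_inv_le_iff₀ (Real.exp_pos _)] at h1
  simp only [norm_real, norm_pow, norm_norm]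
  linarith

section eigenform

variable {f} (hf : IsHeckeCuspForm f)
include hf

lemma norm_fourierCoefficient {n : ℕ} (hn : 1 ≤ n) : ‖fourierCoefficient f n‖ =
    (n : ℝ) ^ (((k : ℝ) - 1) / 2) * ‖heckeEigenvalue f n‖ * ‖fourierCoefficient f 1‖ := by
  rw [fourierCoefficient_eq hf hn, norm_mul, norm_mul,
    norm_natCast_cpow_of_pos hn]
  congr 3
  simp

/-- Since |λ| ≤ |λ|² + 1, the mean-square bound suffices: it gives convergence of ∑|a(n)|² n^(−w)
for Re w > k, and w = Re s + k − 1. The pointwise bound a(n) = O(n^(k/2)) would only reach Re s >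
3/2. -/
lemma LSeriesSummable_heckeEigenvalue {s : ℂ} (hs : 1 < s.re) :
    LSeriesSummable (heckeEigenvalue f) s := by
  have h1 := LSeriesSummable_of_sum_norm_bigO (isBigO_sum_sq_fourierCoefficient f)
    (by positivity) (s := s.re + (k - 1)) (by simp; linarith)
  have h2 : LSeriesSummable (fun _ ↦ 1) s.re :=
    LSeriesSummable_one_iff.mpr (by simpa using hs)
  have ha : 0 < ‖fourierCoefficient f 1‖ := norm_pos_iff.mpr (fourierCoefficient_one_ne_zero hf)
  have h3 := (h1.norm.mul_left (‖fourierCoefficient f 1‖ ^ 2)⁻¹).add h2.norm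
  refine Summable.of_norm_bounded h3 fun n ↦ ?_
  rcases Nat.eq_zero_or_pos n with rfl | hn
  · simp
  have hn' : (0 : ℝ) < n := by exact_mod_cast hn
  rw [LSeries.norm_term_eq, LSeries.norm_term_eq, LSeries.norm_term_eq, if_neg hn.ne',
    if_neg hn.ne', if_neg hn.ne', norm_real, norm_pow, norm_norm, norm_fourierCoefficient hf hn,
    norm_one]
  have h4 : ((s.re : ℂ) + (k - 1) : ℂ).re = s.re + (k - 1) := by simp
  have h5 : ((n : ℝ) ^ (((k : ℝ) - 1) / 2)) ^ 2 = (n : ℝ) ^ ((k : ℝ) - 1) := by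
    rw [← Real.rpow_natCast, ← Real.rpow_mul hn'.le]
    congr 1
    push_cast
    ring
  rw [h4, Real.rpow_add hn', mul_pow, mul_pow, h5, ofReal_re]
  have h6 : (0 : ℝ) < (n : ℝ) ^ ((k : ℝ) - 1) := by positivity
  have h7 : (0 : ℝ) < (n : ℝ) ^ s.re := by positivity
  field_simp
  nlinarith [sq_nonneg (‖heckeEigenvalue f n‖ - 1), norm_nonneg (heckeEigenvalue f n)]

end eigenform

end

/-! ### Decay at cusps and analytic continuation by Mellin transforms -/

section

variable {k : ℕ} (f : CuspForm 𝒮ℒ (k : ℤ))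

lemma continuousOn_lift_vertical (x : ℂ) (hx : x.im = 0) :
    ContinuousOn (fun y : ℝ ↦ lift f (x + y * I)) (Ioi 0) := fun y hy ↦
  (ContinuousAt.comp (f := fun y : ℝ ↦ (x + y * I : ℂ)) (g := lift f)
    (differentiableAt_lift f (by simpa [hx] using hy)).continuousAt
    (by fun_prop)).continuousWithinAt

lemma isBigO_lift_atTop (x : ℂ) (hx : x.im = 0) (r : ℝ) :
    (fun y : ℝ ↦ lift f (x + y * I)) =O[atTop] fun y ↦ y ^ r := by
  obtain ⟨A, C, -, -, h⟩ := lift_decay f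
  refine IsBigO.trans ?_ (isLittleO_exp_neg_mul_rpow_atTop Real.two_pi_pos r).isBigO
  refine IsBigO.of_bound C ?_
  filter_upwards [eventually_ge_atTop A] with y hy
  have := h (x + y * I) (by simpa [hx] using hy)
  rw [Real.norm_of_nonneg (Real.exp_pos _).le]
  simpa [hx] using this

lemma mobius_vertical {a b c d : ℤ} (h : a * d - b * c = 1) (hc : c ≠ 0) {y : ℝ} (hy : 0 < y) :
    (c : ℂ) * ((-d / c : ℂ) + ((1 / (c ^ 2 * y) : ℝ) : ℂ) * I) + d = I / (c * y) ∧
    ((a : ℂ) * ((-d / c : ℂ) + ((1 / (c ^ 2 * y) : ℝ) : ℂ) * I) + b) /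
      (c * ((-d / c : ℂ) + ((1 / (c ^ 2 * y) : ℝ) : ℂ) * I) + d) = a / c + y * I := by
  have hc' : (c : ℂ) ≠ 0 := by exact_mod_cast hc
  have hy' : (y : ℂ) ≠ 0 := by exact_mod_cast hy.ne'
  have hC : (a : ℂ) * d - b * c = 1 := by exact_mod_cast h
  have h1 : (c : ℂ) * ((-d / c : ℂ) + ((1 / (c ^ 2 * y) : ℝ) : ℂ) * I) + d = I / (c * y) := by
    push_cast
    field_simp
    ring
  refine ⟨h1, ?_⟩
  rw [h1, div_eq_iff (div_ne_zero I_ne_zero (mul_ne_zero hc' hy'))]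
  push_cast
  field_simp
  linear_combination -(c : ℂ) * y * hC - c * y * I_sq

/-- The line descending to a/c is the image of the line Re = −d/c going up. The automorphy factor
has size y^(−k), which is why exponent r − k is requested of the decay at infinity. -/
lemma isBigO_lift_zero {a b c d : ℤ} (h : a * d - b * c = 1) (hc : 0 < c) (r : ℝ) :
    (fun y : ℝ ↦ lift f (a / c + y * I)) =O[𝓝[>] 0] fun y ↦ y ^ (-r) := by
  have hcR : (0 : ℝ) < c := by exact_mod_cast hc
  have ht : Tendsto (fun y : ℝ ↦ 1 / ((c : ℝ) ^ 2 * y)) (𝓝[>] 0) atTop := by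
    simp only [one_div, mul_inv]
    exact tendsto_inv_nhdsGT_zero.const_mul_atTop (by positivity)
  have h1 := (isBigO_lift_atTop f (-d / c) (by
    rw [← ofReal_intCast, ← ofReal_intCast, ← ofReal_neg, ← ofReal_div, ofReal_im])
    (r - k)).comp_tendsto ht
  have h2 : (fun y : ℝ ↦ ((I / (c * y)) ^ k : ℂ)) =O[𝓝[>] 0] fun y : ℝ ↦ (1 / (c * y)) ^ k := by
    refine IsBigO.of_bound 1 (Eventually.of_forall fun y ↦ ?_)
    simp
  refine ((h2.mul h1).trans ?_).congr' ?_ EventuallyEq.rfl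
  rotate_left
  · filter_upwards [self_mem_nhdsWithin] with y hy
    have hm := mobius_vertical h hc.ne' hy
    rw [← hm.2, lift_mobius f h, hm.1]
    · rfl
    · have : (-d / c : ℂ).im = 0 := by
        rw [← ofReal_intCast, ← ofReal_intCast, ← ofReal_neg, ← ofReal_div, ofReal_im]
      rw [add_im, this, zero_add, im_ofReal_mul, Complex.I_im, mul_one]
      have : (0 : ℝ) < y := hy
      positivity
  · refine IsBigO.of_bound ((1 / c) ^ k * (1 / c ^ 2) ^ (r - k) : ℝ) ?_
    filter_upwards [self_mem_nhdsWithin] with y hy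
    have hy : (0 : ℝ) < y := hy
    rw [Real.norm_of_nonneg (by simp only [Function.comp]; positivity),
      Real.norm_of_nonneg (by positivity)]
    apply le_of_eq
    simp only [Function.comp]
    rw [← div_div (1 : ℝ) (c ^ 2) y, ← div_div (1 : ℝ) c y, div_eq_mul_one_div _ y,
      div_eq_mul_one_div (1 / (c : ℝ) ^ 2) y, Real.mul_rpow (by positivity) (by positivity), mul_pow]
    have : (1 / y) ^ k * (1 / y) ^ (r - k) = y ^ (-r) := by
      rw [one_div, Real.inv_rpow hy.le, ← Real.rpow_neg hy.le, inv_pow, ← Real.rpow_natCast,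
        ← Real.rpow_neg hy.le, ← Real.rpow_add hy]
      congr 1
      ring
    rw [← this]
    ring

/-- Every rational number is the image of `∞` under an element of `SL₂(ℤ)`. -/
lemma exists_matrix_rat (x : ℚ) :
    ∃ a b c d : ℤ, a * d - b * c = 1 ∧ 0 < c ∧ (x : ℂ) = a / c := by
  have h := Int.isCoprime_iff_gcd_eq_one.mpr (by simpa [Int.gcd] using x.reduced :
    Int.gcd x.num (x.den : ℤ) = 1)
  obtain ⟨u, v, huv⟩ := h
  refine ⟨x.num, -v, x.den, u, by linear_combination huv, by exact_mod_cast x.den_pos, ?_⟩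
  exact_mod_cast (Rat.num_div_den x).symm

lemma ratCast_im (x : ℚ) : (x : ℂ).im = 0 := by
  rw [← ofReal_ratCast, ofReal_im]

/-- The restriction of a cusp form to the vertical line with real part `x`. -/
noncomputable def vertical (x : ℚ) (y : ℝ) : ℂ := lift f (x + y * I)

lemma locallyIntegrableOn_vertical (x : ℚ) : LocallyIntegrableOn (vertical f x) (Ioi 0) :=
  (continuousOn_lift_vertical f x (ratCast_im x)).locallyIntegrableOn measurableSet_Ioi

lemma isBigO_vertical_zero (x : ℚ) (r : ℝ) :
    vertical f x =O[𝓝[>] 0] fun y ↦ y ^ (-r) := by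
  obtain ⟨a, b, c, d, h, hc, hx⟩ := exists_matrix_rat x
  have := isBigO_lift_zero f h hc r
  rw [← hx] at this
  exact this

lemma mellinConvergent_vertical (x : ℚ) (s : ℂ) : MellinConvergent (vertical f x) s :=
  mellinConvergent_of_isBigO_rpow (a := s.re + 1) (b := s.re - 1)
    (locallyIntegrableOn_vertical f x) (isBigO_lift_atTop f x (ratCast_im x) _) (by linarith)
    (isBigO_vertical_zero f x _) (by linarith)

lemma differentiable_mellin_vertical (x : ℚ) : Differentiable ℂ (mellin (vertical f x)) := fun s ↦
  mellin_differentiableAt_of_isBigO_rpow (a := s.re + 1) (b := s.re - 1)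
    (locallyIntegrableOn_vertical f x) (isBigO_lift_atTop f x (ratCast_im x) _) (by linarith)
    (isBigO_vertical_zero f x _) (by linarith)

section eigenform

variable {f} (hf : IsHeckeCuspForm f)

include hf

/-- The shift (k−1)/2 absorbs the factor n^((k−1)/2) between a(n) and λ_f(n). Absolute convergence
justifies integrating term by term. -/
lemma hasSum_mellin_vertical (x : ℚ) {s : ℂ} (hs : 1 < s.re) :
    HasSum (fun n : ℕ ↦ Gamma (s + (k - 1) / 2) *
      (fourierCoefficient f n * exp (2 * Real.pi * I * (n * x))) /
        ((2 * Real.pi * n : ℝ) : ℂ) ^ (s + (k - 1) / 2))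
      (mellin (vertical f x) (s + (k - 1) / 2)) := by
  have hre : (s + (k - 1) / 2).re = s.re + (k - 1) / 2 := by simp
  have hk : (0 : ℝ) ≤ k := by positivity
  refine hasSum_mellin (fun n ↦ ?_) (by rw [hre]; linarith) (fun y hy ↦ ?_) ?_
  -- For n = 0 the exponential does not decay, but the constant coefficient of a cusp form vanishes.
  · rcases Nat.eq_zero_or_pos n with rfl | hn
    · simp [fourierCoefficient_zero]
    · right
      positivity
  · have h := hasSum_lift f (z := x + y * I) (by simpa [ratCast_im] using hy)
    convert! h using 2 with n
    rw [mul_assoc, ofReal_exp, ← exp_add]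
    congr 2
    push_cast
    linear_combination -2 * Real.pi * n * y * I_sq
  · have h := ((LSeriesSummable_heckeEigenvalue hf hs).norm.mul_left
      (‖fourierCoefficient f 1‖ / (2 * Real.pi) ^ (s.re + (k - 1) / 2)))
    refine h.congr fun n ↦ ?_
    rcases Nat.eq_zero_or_pos n with rfl | hn
    · simp [fourierCoefficient_zero]
    have hn' : (0 : ℝ) < n := by exact_mod_cast hn
    have hexp : ‖exp (2 * (Real.pi : ℂ) * I * ((n : ℂ) * (x : ℂ)))‖ = 1 := by
      have : (2 * (Real.pi : ℂ) * I * ((n : ℂ) * (x : ℂ))) =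
          ((2 * Real.pi * (n * x) : ℝ) : ℂ) * I := by
        push_cast
        ring
      rw [this, norm_exp_ofReal_mul_I]
    rw [LSeries.norm_term_eq, if_neg hn.ne', norm_mul, hexp, mul_one, hre,
      norm_fourierCoefficient hf hn, Real.mul_rpow (by positivity) hn'.le, Real.rpow_add hn' s.re]
    have h6 : (0 : ℝ) < (n : ℝ) ^ (((k : ℝ) - 1) / 2) := by positivity
    have h7 : (0 : ℝ) < (n : ℝ) ^ s.re := by positivity
    field_simp

/-- The entire continuation of `L(s, f ⊗ e(x))` as a Mellin transform. -/
lemma isEntireContinuation_mellin (x : ℚ) : IsEntireContinuation (addTwist f x) (fun s ↦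
    (2 * Real.pi : ℂ) ^ (s + (k - 1) / 2) * (Gamma (s + (k - 1) / 2))⁻¹ *
      (fourierCoefficient f 1)⁻¹ * mellin (vertical f x) (s + (k - 1) / 2)) := by
  have hpi : (2 * Real.pi : ℂ) ≠ 0 := by simp [Real.pi_ne_zero]
  have ha := fourierCoefficient_one_ne_zero hf
  have hshift : Differentiable ℂ fun s : ℂ ↦ s + (k - 1) / 2 := by fun_prop
  constructor
  · refine ((Differentiable.mul ?_ ?_).mul_const _).mul
      ((differentiable_mellin_vertical f x).comp hshift)
    · exact fun s ↦ (hshift s).const_cpow (Or.inl hpi)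
    · exact differentiable_one_div_Gamma.comp hshift
  · intro s hs
    have hre : 0 < (s + (k - 1) / 2).re := by
      have hk : (0 : ℝ) ≤ k := by positivity
      simp only [add_re, div_ofNat_re, sub_re, natCast_re, one_re]
      linarith
    have hG := Gamma_ne_zero_of_re_pos hre
    have h := (hasSum_mellin_vertical hf x hs).mul_left ((2 * Real.pi : ℂ) ^ (s + (k - 1) / 2) *
      (Gamma (s + (k - 1) / 2))⁻¹ * (fourierCoefficient f 1)⁻¹)
    rw [LSeriesHasSum]
    convert! h using 1
    funext n
    rcases Nat.eq_zero_or_pos n with rfl | hn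
    · simp [fourierCoefficient_zero]
    have hn' : (n : ℂ) ≠ 0 := by exact_mod_cast hn.ne'
    have h1 : ((2 * Real.pi * n : ℝ) : ℂ) ^ (s + (k - 1) / 2) =
        (2 * Real.pi : ℂ) ^ (s + (k - 1) / 2) *
          ((n : ℂ) ^ s * (n : ℂ) ^ (((k : ℂ) - 1) / 2)) := by
      rw [ofReal_mul, mul_cpow_ofReal_nonneg (by positivity) (by positivity), ofReal_natCast,
        ← cpow_add _ _ hn']
      push_cast
      rfl
    have h2 : (2 * Real.pi : ℂ) ^ (s + (k - 1) / 2) ≠ 0 := by simp [cpow_eq_zero_iff, hpi]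
    have h3 : (n : ℂ) ^ s ≠ 0 := by simp [cpow_eq_zero_iff, hn']
    have h4 : (n : ℂ) ^ (((k : ℂ) - 1) / 2) ≠ 0 := by simp [cpow_eq_zero_iff, hn']
    rw [LSeries.term_of_ne_zero hn.ne', h1, fourierCoefficient_eq hf hn, addTwist]
    generalize Gamma (s + (k - 1) / 2) = G at hG
    field_simp

omit hf in
lemma isEntireContinuation_continuedLSeries {a : ℕ → ℂ} {F : ℂ → ℂ}
    (h : IsEntireContinuation a F) : IsEntireContinuation a (continuedLSeries a) := by
  have h' : ∃ F : ℂ → ℂ, IsEntireContinuation a F := ⟨F, h⟩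
  have : continuedLSeries a = h'.choose := by
    funext s
    rw [continuedLSeries, dif_pos h']
  rw [this]
  exact h'.choose_spec

lemma isEntireContinuation_LAdd (x : ℚ) : IsEntireContinuation (addTwist f x) (LAdd f x) :=
  isEntireContinuation_continuedLSeries (isEntireContinuation_mellin hf x)

omit hf in
lemma addTwist_zero : addTwist f 0 = heckeEigenvalue f := by
  funext n
  simp [addTwist]

omit hf in
lemma LAdd_zero : LAdd f 0 = L f := by
  funext s
  rw [LAdd, addTwist_zero, L]

lemma isEntireContinuation_L : IsEntireContinuation (heckeEigenvalue f) (L f) := by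
  simpa only [addTwist_zero, LAdd_zero] using isEntireContinuation_LAdd hf 0

omit hf in
lemma LAdd_eq_of_sub_int {x y : ℚ} {n : ℤ} (h : x - y = n) : LAdd f x = LAdd f y := by
  have : addTwist f x = addTwist f y := by
    funext m
    rw [addTwist, addTwist]
    congr 1
    rw [exp_eq_exp_iff_exists_int]
    refine ⟨m * n, ?_⟩
    have hC : (x : ℂ) - y = n := by exact_mod_cast h
    push_cast
    linear_combination 2 * Real.pi * I * m * hC
  funext s
  rw [LAdd, LAdd, this]

lemma mellin_vertical_eq (x : ℚ) {w : ℂ} (hw : 0 < w.re) : mellin (vertical f x) w =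
    fourierCoefficient f 1 * (2 * Real.pi : ℂ) ^ (-w) * Gamma w * LAdd f x (w - (k - 1) / 2) := by
  have hpi : (2 * Real.pi : ℂ) ≠ 0 := by simp [Real.pi_ne_zero]
  have ha := fourierCoefficient_one_ne_zero hf
  have hG := Gamma_ne_zero_of_re_pos hw
  have h2 : (2 * Real.pi : ℂ) ^ w ≠ 0 := by simp [cpow_eq_zero_iff, hpi]
  rw [(isEntireContinuation_LAdd hf x).unique (isEntireContinuation_mellin hf x)]
  simp only [sub_add_cancel]
  rw [cpow_neg]
  field_simp

end eigenform

end

/-! ### Eichler integrals: primitives of f P and their boundary values at cusps -/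

section

/-- This crude bound is enough because f decays like e^(−2πy) and 2π > 2. -/
lemma exists_norm_eval_le (P : Polynomial ℂ) (R : ℝ) :
    ∃ A : ℝ, ∀ z : ℂ, |z.re| ≤ R → A ≤ z.im → ‖P.eval z‖ ≤ Real.exp (R + z.im) := by
  let Q : Polynomial ℝ :=
    ∑ i ∈ Finset.range (P.natDegree + 1), Polynomial.C ‖P.coeff i‖ * Polynomial.X ^ i
  have h := (Polynomial.tendsto_div_exp_atTop Q).eventually (gt_mem_nhds one_pos)
  obtain ⟨A, hA⟩ := eventually_atTop.mp h
  refine ⟨max 0 (A - R), fun z hz hz' ↦ ?_⟩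
  have h0 : 0 ≤ z.im := (le_max_left _ _).trans hz'
  have h1 := hA (R + z.im) (by linarith [le_max_right 0 (A - R)])
  have h2 : ‖z‖ ≤ R + z.im := by
    have := norm_le_abs_re_add_abs_im z
    rw [abs_of_nonneg h0] at this
    linarith
  rw [div_lt_one (Real.exp_pos _)] at h1
  refine le_trans ?_ h1.le
  rw [Polynomial.eval_eq_sum_range]
  simp only [Q, Polynomial.eval_finsetSum, Polynomial.eval_mul, Polynomial.eval_C,
    Polynomial.eval_pow, Polynomial.eval_X]
  refine (norm_sum_le _ _).trans (Finset.sum_le_sum fun i _ ↦ ?_)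
  rw [norm_mul, norm_pow]
  gcongr

/-- The bound N on the degree lets (cz+d)^N clear all denominators. -/
lemma exists_polynomial_mobius (P : Polynomial ℂ) {N : ℕ} (hP : P.natDegree ≤ N) (a b c d : ℤ) :
    ∃ Q : Polynomial ℂ, ∀ z : ℂ, (c : ℂ) * z + d ≠ 0 →
      Q.eval z = (c * z + d) ^ N * P.eval ((a * z + b) / (c * z + d)) := by
  refine ⟨∑ i ∈ Finset.range (N + 1), Polynomial.C (P.coeff i) *
    (Polynomial.C (a : ℂ) * Polynomial.X + Polynomial.C (b : ℂ)) ^ i *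
    (Polynomial.C (c : ℂ) * Polynomial.X + Polynomial.C (d : ℂ)) ^ (N - i), fun z hz ↦ ?_⟩
  rw [Polynomial.eval_eq_sum_range' (Nat.lt_succ_of_le hP), Finset.mul_sum,
    Polynomial.eval_finsetSum]
  refine Finset.sum_congr rfl fun i hi ↦ ?_
  have hi : i ≤ N := Nat.lt_succ_iff.mp (Finset.mem_range.mp hi)
  simp only [Polynomial.eval_mul, Polynomial.eval_C, Polynomial.eval_pow, Polynomial.eval_add,
    Polynomial.eval_X]
  have hzi : ((c : ℂ) * z + d) ^ i ≠ 0 := pow_ne_zero _ hz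
  have hN : ((c : ℂ) * z + d) ^ N = (c * z + d) ^ (N - i) * (c * z + d) ^ i := by
    rw [← pow_add, Nat.sub_add_cancel hi]
  rw [div_pow, hN]
  generalize ((c : ℂ) * z + d) ^ i = w at hzi
  field_simp

variable {k : ℕ} (f : CuspForm 𝒮ℒ (k : ℤ))

/-- `H` is a primitive of `f P` on the upper half plane. -/
def IsEichlerPrimitive (P : Polynomial ℂ) (H : ℂ → ℂ) : Prop :=
  ∀ z : ℂ, 0 < z.im → HasDerivAt H (lift f z * P.eval z) z

lemma exists_isEichlerPrimitive (P : Polynomial ℂ) : ∃ H, IsEichlerPrimitive f P H := by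
  obtain ⟨H, hH⟩ := (convex_halfSpace_im_gt 0).exists_forall_hasDerivWithinAt (𝕜 := ℂ)
    (f := fun z ↦ lift f z * P.eval z) fun z hz ↦
      ((differentiableAt_lift f hz).mul P.differentiable.differentiableAt).differentiableWithinAt
  exact ⟨H, fun z hz ↦ (hH z hz).hasDerivAt
    ((isOpen_lt continuous_const Complex.continuous_im).mem_nhds hz)⟩

variable {f}

/-- The factor (cz+d)^k from modularity and (cz+d)^(−2) from the derivative of the Möbius map leave
(cz+d)^(k−2), which acts on P. -/
lemma IsEichlerPrimitive.mobius {P Q : Polynomial ℂ} {H : ℂ → ℂ} (hH : IsEichlerPrimitive f P H)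
    (hk : 2 ≤ k) {a b c d : ℤ} (h : a * d - b * c = 1)
    (hQ : ∀ z : ℂ, (c : ℂ) * z + d ≠ 0 →
      Q.eval z = (c * z + d) ^ (k - 2) * P.eval ((a * z + b) / (c * z + d))) :
    IsEichlerPrimitive f Q fun z ↦ H ((a * z + b) / (c * z + d)) := by
  intro z hz
  obtain ⟨h0, h1, -⟩ := im_mobius_pos h hz
  have hC : (a : ℂ) * d - b * c = 1 := by exact_mod_cast h
  have h2 : HasDerivAt (fun z : ℂ ↦ ((a : ℂ) * z + b) / (c * z + d)) (1 / (c * z + d) ^ 2) z := by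
    have h3 := (((hasDerivAt_id z).const_mul (a : ℂ)).add_const (b : ℂ)).div
      (((hasDerivAt_id z).const_mul (c : ℂ)).add_const (d : ℂ)) h0
    refine h3.congr_deriv ?_
    simp only [id]
    congr 1
    linear_combination hC
  refine (HasDerivAt.comp z (hH _ h1) h2).congr_deriv ?_
  rw [lift_mobius f h hz, hQ z h0]
  obtain ⟨r, rfl⟩ := Nat.exists_eq_add_of_le hk
  rw [Nat.add_sub_cancel_left, pow_add]
  field_simp

/-- Integrability gives the limit on the imaginary axis, and a horizontal move at height y costs
O(e^(−y)). Independence of x makes the boundary value depend on the cusp only: matrices with the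
same image of ∞ differ by a translation, up to sign. -/
lemma IsEichlerPrimitive.exists_tendsto {P : Polynomial ℂ} {H : ℂ → ℂ}
    (hH : IsEichlerPrimitive f P H) :
    ∃ ℓ : ℂ, ∀ x : ℝ, Tendsto (fun y : ℝ ↦ H (x + y * I)) atTop (𝓝 ℓ) := by
  obtain ⟨A, C, hA0, hC0, hC⟩ := lift_decay f
  have hbound (R : ℝ) : ∃ B, 0 < B ∧ ∀ z : ℂ, |z.re| ≤ R → B ≤ z.im →
      ‖lift f z * P.eval z‖ ≤ C * Real.exp R * Real.exp (-z.im) := by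
    obtain ⟨A', hA'⟩ := exists_norm_eval_le P R
    refine ⟨max A A', by positivity, fun z hz hz' ↦ ?_⟩
    have h1 := hC z ((le_max_left _ _).trans hz')
    have h2 := hA' z hz ((le_max_right _ _).trans hz')
    have h3 : 0 < z.im := hA0.trans_le ((le_max_left _ _).trans hz')
    rw [norm_mul]
    calc _ ≤ (C * Real.exp (-2 * Real.pi * z.im)) * Real.exp (R + z.im) := by gcongr
      _ = C * Real.exp (R + (-2 * Real.pi * z.im + z.im)) := by
        rw [mul_assoc, ← Real.exp_add]
        ring_nf
      _ ≤ C * Real.exp (R + -z.im) := by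
        gcongr
        nlinarith [Real.pi_gt_three]
      _ = _ := by rw [Real.exp_add, mul_assoc]
  have hderiv (x y : ℝ) (hy : 0 < y) : HasDerivAt (fun y : ℝ ↦ H (x + y * I))
      (lift f (x + y * I) * P.eval (x + y * I) * I) y := by
    have h1 : HasDerivAt (fun y : ℝ ↦ (x + y * I : ℂ)) I y := by
      simpa using ((hasDerivAt_id y).ofReal_comp.mul_const I).const_add (x : ℂ)
    exact (hH _ (by simpa using hy)).comp y h1
  obtain ⟨B, hB0, hB⟩ := hbound 0
  have hlim : ∃ ℓ : ℂ, Tendsto (fun y : ℝ ↦ H (y * I)) atTop (𝓝 ℓ) := by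
    refine ⟨_, tendsto_limUnder_of_hasDerivAt_of_integrableOn_Ioi (a := B)
      (f' := fun y : ℝ ↦ lift f (y * I) * P.eval (y * I) * I) (fun y hy ↦ ?_) ?_⟩
    · simpa using hderiv 0 y (hB0.trans hy)
    · refine Integrable.mono' ((exp_neg_integrableOn_Ioi B one_pos).const_mul
        (C * Real.exp 0)) ?_ ?_
      · refine ContinuousOn.aestronglyMeasurable (fun y hy ↦ ?_) measurableSet_Ioi
        have h1 : ContinuousAt (fun y : ℝ ↦ lift f (y * I)) y := by
          simpa using (continuousOn_lift_vertical f 0 rfl).continuousAt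
            (Ioi_mem_nhds (hB0.trans hy))
        have h2 : ContinuousAt (fun y : ℝ ↦ P.eval (y * I : ℂ)) y :=
          (P.continuous.comp (by fun_prop)).continuousAt
        exact ((h1.mul h2).mul_const I).continuousWithinAt
      · filter_upwards [ae_restrict_mem measurableSet_Ioi] with y hy
        rw [norm_mul, norm_I, mul_one]
        simpa using hB (y * I) (by simp) (by simpa using (le_of_lt hy : B ≤ y))
  obtain ⟨ℓ, hℓ⟩ := hlim
  refine ⟨ℓ, fun x ↦ ?_⟩
  obtain ⟨B, hB0, hB⟩ := hbound |x|
  have hdiff : Tendsto (fun y : ℝ ↦ H (x + y * I) - H (y * I)) atTop (𝓝 0) := by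
    refine squeeze_zero_norm' (a := fun y ↦ C * Real.exp |x| * Real.exp (-y) * |x|) ?_ ?_
    · filter_upwards [eventually_ge_atTop B] with y hy
      have hconv : Convex ℝ {z : ℂ | |z.re| ≤ |x| ∧ z.im = y} := by
        intro u hu v hv s t hs ht hst
        refine ⟨?_, ?_⟩
        · simp only [add_re, real_smul, re_ofReal_mul]
          refine (abs_add_le _ _).trans ?_
          rw [abs_mul, abs_mul, abs_of_nonneg hs, abs_of_nonneg ht]
          calc _ ≤ s * |x| + t * |x| := add_le_add (mul_le_mul_of_nonneg_left hu.1 hs)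
                (mul_le_mul_of_nonneg_left hv.1 ht)
            _ = |x| := by rw [← add_mul, hst, one_mul]
        · simp only [add_im, real_smul, im_ofReal_mul, hu.2, hv.2]
          rw [← add_mul, hst, one_mul]
      have := Convex.norm_image_sub_le_of_norm_hasDerivWithin_le (f := H)
        (f' := fun z ↦ lift f z * P.eval z) (s := {z : ℂ | |z.re| ≤ |x| ∧ z.im = y})
        (x := (y * I : ℂ)) (y := (x + y * I : ℂ)) (C := C * Real.exp |x| * Real.exp (-y))
        (fun z hz ↦ (hH z (hz.2 ▸ hB0.trans_le hy)).hasDerivWithinAt)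
        (fun z hz ↦ by
          have := hB z hz.1 (hz.2 ▸ hy)
          rwa [hz.2] at this) hconv (by simp) (by simp)
      simpa using this
    · have : Tendsto (fun y : ℝ ↦ Real.exp (-y)) atTop (𝓝 0) :=
        Real.tendsto_exp_atBot.comp tendsto_neg_atTop_atBot
      simpa using (this.const_mul (C * Real.exp |x|)).mul_const |x|
  simpa using hdiff.add hℓ

lemma IsEichlerPrimitive.exists_tendsto_mobius {P : Polynomial ℂ} {H : ℂ → ℂ}
    (hH : IsEichlerPrimitive f P H) (hk : 2 ≤ k) (hP : P.natDegree ≤ k - 2)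
    {a b c d : ℤ} (h : a * d - b * c = 1) :
    ∃ ℓ : ℂ, ∀ x : ℝ, Tendsto (fun y : ℝ ↦
      H ((a * (x + y * I) + b) / (c * (x + y * I) + d))) atTop (𝓝 ℓ) := by
  obtain ⟨Q, hQ⟩ := exists_polynomial_mobius P hP a b c d
  exact (hH.mobius hk h hQ).exists_tendsto

lemma integrableOn_vertical_mul_pow (f : CuspForm 𝒮ℒ (k : ℤ)) (x : ℚ) (j : ℕ) :
    IntegrableOn (fun y : ℝ ↦ vertical f x y * (y : ℂ) ^ j) (Ioi 0) ∧
    ∫ y in Ioi (0 : ℝ), vertical f x y * (y : ℂ) ^ j = mellin (vertical f x) (j + 1) := by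
  have h := mellinConvergent_vertical f x (j + 1)
  rw [MellinConvergent] at h
  simp only [add_sub_cancel_right, cpow_natCast, smul_eq_mul, mul_comm (_ ^ j)] at h
  refine ⟨h, ?_⟩
  simp only [mellin, add_sub_cancel_right, cpow_natCast, smul_eq_mul, mul_comm (_ ^ j)]

lemma integral_vertical_mul_sum (f : CuspForm 𝒮ℒ (k : ℤ)) (x : ℚ) (s : Finset ℕ) (e : ℕ → ℕ)
    (c : ℕ → ℂ) :
    IntegrableOn (fun y : ℝ ↦ vertical f x y * ∑ j ∈ s, c j * (y : ℂ) ^ e j) (Ioi 0) ∧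
    ∫ y in Ioi (0 : ℝ), vertical f x y * ∑ j ∈ s, c j * (y : ℂ) ^ e j =
      ∑ j ∈ s, c j * mellin (vertical f x) (e j + 1) := by
  have h0 (y : ℝ) : vertical f x y * ∑ j ∈ s, c j * (y : ℂ) ^ e j =
      ∑ j ∈ s, c j * (vertical f x y * (y : ℂ) ^ e j) := by
    rw [Finset.mul_sum]
    exact Finset.sum_congr rfl fun j _ ↦ by ring
  have h1 (j : ℕ) := integrableOn_vertical_mul_pow f x (e j)
  simp only [h0]
  refine ⟨integrable_finsetSum _ fun j _ ↦ (h1 j).1.const_mul (c j), ?_⟩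
  rw [integral_finsetSum _ fun j _ ↦ (h1 j).1.const_mul (c j)]
  refine Finset.sum_congr rfl fun j _ ↦ ?_
  rw [integral_const_mul, (h1 j).2]

lemma integrableOn_vertical_mul_eval (f : CuspForm 𝒮ℒ (k : ℤ)) (x : ℚ) (P : Polynomial ℂ) :
    IntegrableOn (fun y : ℝ ↦ vertical f x y * P.eval (x + y * I)) (Ioi 0) := by
  let Q := P.comp (Polynomial.C (x : ℂ) + Polynomial.C I * Polynomial.X)
  have h := (integral_vertical_mul_sum f x (Finset.range (Q.natDegree + 1)) id Q.coeff).1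
  simp only [id, ← Polynomial.eval_eq_sum_range] at h
  simpa [Q, Polynomial.eval_comp, mul_comm I] using h

/-- The integral of `f P` along the vertical line ending at a rational number is the difference
of the boundary values at the two cusps of a primitive. -/
lemma IsEichlerPrimitive.integral_vertical {P : Polynomial ℂ} {H : ℂ → ℂ}
    (hH : IsEichlerPrimitive f P H) {a b c d : ℤ} (h : a * d - b * c = 1) (hc : 0 < c)
    {x : ℚ} (hx : (x : ℂ) = a / c) {ℓ₁ ℓ₀ : ℂ}
    (h₁ : ∀ x : ℝ, Tendsto (fun y : ℝ ↦ H (x + y * I)) atTop (𝓝 ℓ₁))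
    (h₀ : ∀ x : ℝ, Tendsto (fun y : ℝ ↦
      H ((a * (x + y * I) + b) / (c * (x + y * I) + d))) atTop (𝓝 ℓ₀)) :
    I * ∫ y in Ioi (0 : ℝ), vertical f x y * P.eval (x + y * I) = ℓ₁ - ℓ₀ := by
  have hcR : (0 : ℝ) < c := by exact_mod_cast hc
  have hderiv (y : ℝ) (hy : y ∈ Ioi 0) : HasDerivAt (fun y : ℝ ↦ H (x + y * I))
      (I * (vertical f x y * P.eval (x + y * I))) y := by
    have h1 : HasDerivAt (fun y : ℝ ↦ (x + y * I : ℂ)) I y := by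
      simpa using ((hasDerivAt_id y).ofReal_comp.mul_const I).const_add (x : ℂ)
    refine ((hH _ (by simpa [ratCast_im] using hy)).comp y h1).congr_deriv ?_
    rw [mul_comm, vertical]
  have ht : Tendsto (fun y : ℝ ↦ 1 / ((c : ℝ) ^ 2 * y)) (𝓝[>] 0) atTop := by
    simp only [one_div, mul_inv]
    exact tendsto_inv_nhdsGT_zero.const_mul_atTop (by positivity)
  have hzero : Tendsto (fun y : ℝ ↦ H (x + y * I)) (𝓝[>] 0) (𝓝 ℓ₀) := by
    -- Descending to a/c corresponds to ascending the line Re = −d/c (`mobius_vertical`).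
    refine ((h₀ (-d / c)).comp ht).congr' ?_
    filter_upwards [self_mem_nhdsWithin] with y hy
    have := (mobius_vertical h hc.ne' hy).2
    rw [hx, ← this]
    simp
  have hinf : Tendsto (fun y : ℝ ↦ H (x + y * I)) atTop (𝓝 ℓ₁) := by
    simpa using h₁ x
  have hint := (integrableOn_vertical_mul_eval f x P).const_mul I
  have := integral_Ioi_deriv_mul_eq_sub (a := (0 : ℝ)) (u := fun y : ℝ ↦ H (x + y * I))
    (v := fun _ ↦ 1) (v' := fun _ ↦ 0)
    (u' := fun y : ℝ ↦ I * (vertical f x y * P.eval (x + y * I))) (a' := ℓ₀) (b' := ℓ₁) hderiv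
    (fun y _ ↦ hasDerivAt_const y 1)
    (by simpa [Pi.mul_def, Pi.add_def, IntegrableOn] using hint) (by simpa [Pi.mul_def] using hzero)
    (by simpa [Pi.mul_def] using hinf)
  simp only [mul_one, mul_zero, add_zero] at this
  rw [← this, integral_const_mul]

end

/-! ### Period relations between vertical integrals -/

section

variable {k : ℕ} (f : CuspForm 𝒮ℒ (k : ℤ))

lemma integral_vertical_center (x : ℚ) (m : ℕ) :
    ∫ y in Ioi (0 : ℝ), vertical f x y *
      ((Polynomial.X - Polynomial.C (x : ℂ)) ^ m).eval (x + y * I) =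
      I ^ m * mellin (vertical f x) (m + 1) := by
  have h := (integral_vertical_mul_sum f x {0} (fun _ ↦ m) (fun _ ↦ I ^ m)).2
  simp only [Finset.sum_singleton] at h
  rw [← h]
  congr 1
  funext y
  simp [mul_pow, mul_comm]

/-- The zero of order m at 0 makes every power of y at least m, so only values at 1/2 + j with j ≥ 0
occur. -/
lemma integral_vertical_zero (m : ℕ) (t : ℂ) :
    ∫ y in Ioi (0 : ℝ), vertical f 0 y *
      ((Polynomial.X ^ m * (1 - Polynomial.C t * Polynomial.X) ^ m).eval (((0 : ℚ) : ℂ) + y * I)) =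
      ∑ j ∈ Finset.range (m + 1), (m.choose j * (-t) ^ j * I ^ (m + j)) *
        mellin (vertical f 0) ((m + j : ℕ) + 1) := by
  rw [← (integral_vertical_mul_sum f 0 (Finset.range (m + 1)) (fun j ↦ m + j)
    (fun j ↦ m.choose j * (-t) ^ j * I ^ (m + j))).2]
  congr 1
  funext y
  congr 1
  simp only [Rat.cast_zero, zero_add, Polynomial.eval_mul, Polynomial.eval_pow, Polynomial.eval_X,
    Polynomial.eval_sub, Polynomial.eval_one, Polynomial.eval_C]
  rw [show (1 - t * (y * I) : ℂ) = (-t) * (y * I) + 1 by ring, add_pow, Finset.mul_sum]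
  refine Finset.sum_congr rfl fun j _ ↦ ?_
  rw [one_pow]
  ring

/-- At z = x + iy one has z(1 − z/x) = −iy(1 + iy/x): again a zero of order m, now at x, and the
source of the sign (−1)^m. -/
lemma integral_vertical_inv (x : ℚ) (hx : x ≠ 0) (m : ℕ) :
    ∫ y in Ioi (0 : ℝ), vertical f x y *
      ((Polynomial.X ^ m * (1 - Polynomial.C (x⁻¹ : ℂ) * Polynomial.X) ^ m).eval (x + y * I)) =
      ∑ j ∈ Finset.range (m + 1), (m.choose j * (-1) ^ m * (x⁻¹ : ℂ) ^ j * I ^ (m + j)) *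
        mellin (vertical f x) ((m + j : ℕ) + 1) := by
  have hx' : (x : ℂ) ≠ 0 := by exact_mod_cast hx
  rw [← (integral_vertical_mul_sum f x (Finset.range (m + 1)) (fun j ↦ m + j)
    (fun j ↦ m.choose j * (-1) ^ m * (x⁻¹ : ℂ) ^ j * I ^ (m + j))).2]
  congr 1
  funext y
  congr 1
  simp only [Polynomial.eval_mul, Polynomial.eval_pow, Polynomial.eval_X,
    Polynomial.eval_sub, Polynomial.eval_one, Polynomial.eval_C]
  rw [← mul_pow, show ((x + y * I) * (1 - (x : ℂ)⁻¹ * (x + y * I)) : ℂ) =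
    (-1 * (y * I)) * ((x : ℂ)⁻¹ * (y * I) + 1) by field_simp; ring, mul_pow, add_pow,
    Finset.mul_sum]
  refine Finset.sum_congr rfl fun j _ ↦ ?_
  rw [one_pow]
  ring

section reciprocity

variable {m : ℕ} (hk : k = 2 * m + 2) {p q u v : ℤ} (h : p * u + q * v = 1) (hp : 0 < p)
  (hq : 0 < q)
include hk h hp hq

/-- The three-term relation between the integrals of `f` with endpoints `u / q`, `0`, `q / p`. -/
lemma mellin_three_term {x y : ℚ} (hx : x = u / q) (hy : y = q / p) :
    I ^ m * mellin (vertical f x) (m + 1) =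
      ∑ j ∈ Finset.range (m + 1), (m.choose j * (-(y⁻¹ : ℂ)) ^ j * I ^ (m + j)) *
        mellin (vertical f 0) ((m + j : ℕ) + 1) -
      ∑ j ∈ Finset.range (m + 1), (m.choose j * (-1) ^ m * (y⁻¹ : ℂ) ^ j * I ^ (m + j)) *
        mellin (vertical f y) ((m + j : ℕ) + 1) := by
  have hp' : (p : ℂ) ≠ 0 := by exact_mod_cast hp.ne'
  have hq' : (q : ℂ) ≠ 0 := by exact_mod_cast hq.ne'
  have hC : (p : ℂ) * u + q * v = 1 := by exact_mod_cast h
  have hxC : (x : ℂ) = u / q := by rw [hx]; push_cast; rfl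
  have hyC : (y : ℂ) = q / p := by rw [hy]; push_cast; rfl
  have hy0 : y ≠ 0 := by
    intro h0
    rw [h0, Rat.cast_zero] at hyC
    exact div_ne_zero hq' hp' hyC.symm
  -- Degree 2m = k − 2, with zeros of order m at the two cusps 0 and y = q/p.
  set Q : Polynomial ℂ := Polynomial.X ^ m * (1 - Polynomial.C (y⁻¹ : ℂ) * Polynomial.X) ^ m with hQ
  have hdeg : Q.natDegree ≤ k - 2 := by
    have : (1 - Polynomial.C (y⁻¹ : ℂ) * Polynomial.X).natDegree ≤ 1 := by compute_degree
    refine Polynomial.natDegree_mul_le.trans ?_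
    have h1 := Polynomial.natDegree_pow_le (p := 1 - Polynomial.C (y⁻¹ : ℂ) * Polynomial.X) (n := m)
    have h2 : m * (1 - Polynomial.C (y⁻¹ : ℂ) * Polynomial.X).natDegree ≤ m * 1 :=
      Nat.mul_le_mul_left m this
    rw [Polynomial.natDegree_X_pow]
    omega
  have h2k : 2 ≤ k := by omega
  obtain ⟨K, hK⟩ := exists_isEichlerPrimitive f Q
  -- The matrix γ = (q, −u; p, v) sends u/q to 0 and ∞ to q/p, so it pulls Q back to a polynomial
  -- with its zero of order m at u/q and degree m.
  have hdet : q * v - (-u) * p = 1 := by linear_combination h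
  have hprim := hK.mobius (Q := (Polynomial.X - Polynomial.C (x : ℂ)) ^ m) h2k hdet
    fun z hz ↦ by
      rw [show k - 2 = m + m by omega, pow_add, hQ]
      simp only [Polynomial.eval_mul, Polynomial.eval_pow, Polynomial.eval_X,
        Polynomial.eval_sub, Polynomial.eval_one, Polynomial.eval_C]
      rw [← mul_pow, ← mul_pow, ← mul_pow, hxC, hyC]
      congr 1
      have e (N D : ℂ) (hD : D ≠ 0) :
          D * D * (N / D * (1 - (q / p : ℂ)⁻¹ * (N / D))) = N * (q * D - p * N) / q := by
        field_simp
      push_cast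
      rw [e _ _ hz, show (q * (p * z + v) - p * (q * z + -u) : ℂ) = 1 by linear_combination hC]
      field_simp
      ring
  obtain ⟨ℓ, hℓ⟩ := hK.exists_tendsto
  obtain ⟨ℓ₁, hℓ₁⟩ := hK.exists_tendsto_mobius h2k hdeg hdet
  obtain ⟨ℓ₀, hℓ₀⟩ := hK.exists_tendsto_mobius h2k hdeg (a := 0) (b := -1) (c := 1) (d := 0)
    (by norm_num)
  have e1 := hK.integral_vertical (x := y) hdet hp hyC hℓ hℓ₁
  have e0 := hK.integral_vertical (x := 0) (a := 0) (b := -1) (c := 1) (d := 0)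
    (by norm_num) one_pos (by simp) hℓ hℓ₀
  -- The matrix (u, −v; q, p) sends ∞ to u/q, and γ times it is (0, −1; 1, 0). Hence the lower
  -- boundary value is that of `K` at 0.
  have hdet' : u * p - (-v) * q = 1 := by linear_combination h
  have e2 := hprim.integral_vertical (x := x) hdet' hq hxC hℓ₁ (ℓ₀ := ℓ₀) fun t ↦ by
    refine (hℓ₀ t).congr' ?_
    filter_upwards [eventually_gt_atTop 0] with s hs
    obtain ⟨h0, h1, -⟩ := im_mobius_pos hdet' (z := t + s * I) (by simpa using hs)
    have hz : (t + s * I : ℂ) ≠ 0 := by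
      intro hz
      have := congrArg Complex.im hz
      simp at this
      exact hs.ne' this
    have h0' := (im_mobius_pos hdet h1).1
    congr 1
    generalize (t + s * I : ℂ) = z at *
    have hw := div_mul_cancel₀ (u * z + (-v : ℤ) : ℂ) h0
    rw [div_eq_div_iff (by simpa using hz) h0']
    generalize (u * z + (-v : ℤ) : ℂ) / (q * z + p) = w at hw
    apply mul_right_cancel₀ h0
    push_cast at hw ⊢
    linear_combination (-p - q * z : ℂ) * hw
  rw [integral_vertical_center] at e2
  rw [hQ, integral_vertical_inv f y hy0] at e1
  rw [hQ, integral_vertical_zero f] at e0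
  apply mul_left_cancel₀ I_ne_zero
  linear_combination e2 - e0 + e1

omit hq in
/-- The functional equation at the central point relating the endpoints `-v / p` and `q / p`. -/
lemma mellin_two_term {x y : ℚ} (hx : x = -v / p) (hy : y = q / p) :
    (-1) ^ m * mellin (vertical f x) (m + 1) = -mellin (vertical f y) (m + 1) := by
  have hp' : (p : ℂ) ≠ 0 := by exact_mod_cast hp.ne'
  have hC : (p : ℂ) * u + q * v = 1 := by exact_mod_cast h
  have hxC : (x : ℂ) = (-v : ℤ) / p := by rw [hx]; push_cast; rfl
  have hyC : (y : ℂ) = q / p := by rw [hy]; push_cast; rfl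
  have h2k : 2 ≤ k := by omega
  -- Since γz − q/p = −1/(p(pz+v)), the factor (−1)^m makes the pullback exactly (z − x)^m.
  obtain ⟨K, hK⟩ := exists_isEichlerPrimitive f
    (Polynomial.C ((-1) ^ m) * (Polynomial.X - Polynomial.C (y : ℂ)) ^ m)
  have hdeg : (Polynomial.C ((-1) ^ m) * (Polynomial.X - Polynomial.C (y : ℂ)) ^ m).natDegree ≤
      k - 2 := by
    refine (Polynomial.natDegree_C_mul_le _ _).trans ?_
    rw [Polynomial.natDegree_pow, Polynomial.natDegree_X_sub_C]
    omega
  have hdet : q * v - (-u) * p = 1 := by linear_combination h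
  have hprim := hK.mobius (Q := (Polynomial.X - Polynomial.C (x : ℂ)) ^ m) h2k hdet
    fun z hz ↦ by
      rw [show k - 2 = m + m by omega, pow_add]
      simp only [Polynomial.eval_mul, Polynomial.eval_pow, Polynomial.eval_X,
        Polynomial.eval_sub, Polynomial.eval_C]
      rw [← mul_pow, ← mul_pow, ← mul_pow, hxC, hyC]
      congr 1
      have e (N D : ℂ) (hD : D ≠ 0) :
          D * D * (-1 * (N / D - q / p)) = D * (q * D - p * N) / p := by
        field_simp
        ring
      push_cast
      rw [e _ _ hz, show (q * (p * z + v) - p * (q * z + -u) : ℂ) = 1 by linear_combination hC]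
      field_simp
      ring
  obtain ⟨ℓ, hℓ⟩ := hK.exists_tendsto
  obtain ⟨ℓ₁, hℓ₁⟩ := hK.exists_tendsto_mobius h2k hdeg hdet
  have e1 := hK.integral_vertical (x := y) hdet hp hyC hℓ hℓ₁
  -- The matrix (−v, −u; p, −q) sends ∞ to −v/p and is the inverse of γ up to sign. So γ maps the
  -- line over −v/p to a path from ∞ to q/p, reversing the orientation.
  have hdet' : (-v) * (-q) - (-u) * p = 1 := by linear_combination h
  have e2 := hprim.integral_vertical (x := x) hdet' hp hxC hℓ₁ (ℓ₀ := ℓ) fun t ↦ by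
    refine (hℓ t).congr' ?_
    filter_upwards [eventually_gt_atTop 0] with s hs
    obtain ⟨h0, h1, -⟩ := im_mobius_pos hdet' (z := t + s * I) (by simpa using hs)
    have h0' := (im_mobius_pos hdet h1).1
    congr 1
    generalize (t + s * I : ℂ) = z at *
    have hw := div_mul_cancel₀ ((-v : ℤ) * z + (-u : ℤ) : ℂ) h0
    rw [eq_div_iff h0']
    generalize ((-v : ℤ) * z + (-u : ℤ) : ℂ) / (p * z + (-q : ℤ)) = w at hw
    apply mul_right_cancel₀ h0
    push_cast at hw ⊢
    linear_combination (z * p - q : ℂ) * hw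
  have hpoly (s : ℝ) : vertical f y s * (Polynomial.C ((-1) ^ m) *
      (Polynomial.X - Polynomial.C (y : ℂ)) ^ m).eval (y + s * I) =
      (-1) ^ m * (vertical f y s * ((Polynomial.X - Polynomial.C (y : ℂ)) ^ m).eval (y + s * I)) := by
    rw [Polynomial.eval_mul, Polynomial.eval_C]
    ring
  simp only [hpoly] at e1
  rw [integral_const_mul, integral_vertical_center] at e1
  rw [integral_vertical_center] at e2
  have hI : I * I ^ m ≠ 0 := mul_ne_zero I_ne_zero (pow_ne_zero _ I_ne_zero)
  have hsq : ((-1 : ℂ) ^ m) * (-1) ^ m = 1 := by rw [← mul_pow]; norm_num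
  apply mul_left_cancel₀ hI
  linear_combination (-1) ^ m * e2 + (-1) ^ m * e1 - I * I ^ m * mellin (vertical f y) (m + 1) * hsq

end reciprocity

end

/-! ### From character twists to additive twists -/

section

lemma isEntireContinuation_sum {ι : Type*} (s : Finset ι) (c : ι → ℂ) {a : ι → ℕ → ℂ}
    {F : ι → ℂ → ℂ} (h : ∀ i ∈ s, IsEntireContinuation (a i) (F i)) :
    IsEntireContinuation (fun n ↦ ∑ i ∈ s, c i * a i n) (fun z ↦ ∑ i ∈ s, c i * F i z) := by
  refine ⟨Differentiable.fun_sum fun i hi ↦ (h i hi).1.const_mul _, fun z hz ↦ ?_⟩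
  have h1 := hasSum_sum fun i hi ↦ ((h i hi).2 z hz).mul_left (c i)
  rw [LSeriesHasSum]
  convert! h1 using 1
  funext n
  rcases eq_or_ne n 0 with rfl | hn
  · simp
  · simp only [LSeries.term_of_ne_zero hn, Finset.sum_div, mul_div_assoc]

variable {k : ℕ} {f : CuspForm 𝒮ℒ (k : ℤ)}

section prime

variable {q : ℕ} [Fact q.Prime]

lemma isPrimitive_iff_ne_one (χ : DirichletCharacter ℂ q) : χ.IsPrimitive ↔ χ ≠ 1 := by
  have hq : q.Prime := Fact.out
  rw [DirichletCharacter.isPrimitive_def, ne_eq,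
    DirichletCharacter.eq_one_iff_conductor_eq_one]
  constructor
  · intro h h'
    exact hq.one_lt.ne (h'.symm.trans h)
  · intro h
    exact (hq.eq_one_or_self_of_dvd _ χ.conductor_dvd_level).resolve_left h

lemma tau_ne_zero {χ : DirichletCharacter ℂ q} (hχ : χ.IsPrimitive) : tau χ ≠ 0 := by
  refine gaussSum_ne_zero_of_nontrivial ?_ ((isPrimitive_iff_ne_one χ).mp hχ)
    (ZMod.isPrimitive_stdAddChar q)
  rw [ZMod.card]
  exact_mod_cast (Fact.out : q.Prime).ne_zero

lemma addTwist_div (b : ZMod q) (n : ℕ) : addTwist f ((b.val : ℚ) / q) n =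
    heckeEigenvalue f n * ZMod.stdAddChar ((n : ZMod q) * b) := by
  have h : ((n : ZMod q) * b) = (((n * b.val : ℕ) : ℤ) : ZMod q) := by
    push_cast
    rw [ZMod.natCast_zmod_val]
  rw [addTwist, h, ZMod.stdAddChar_coe]
  congr 2
  push_cast
  ring

lemma LAdd_intCast_div (u : ℤ) :
    LAdd f ((u : ℚ) / q) = LAdd f (((u : ZMod q).val : ℚ) / q) := by
  have hq : (q : ℚ) ≠ 0 := by exact_mod_cast (Fact.out : q.Prime).ne_zero
  have h : (((u : ZMod q).val : ℤ) : ZMod q) = (u : ZMod q) := by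
    rw [Int.cast_natCast, ZMod.natCast_zmod_val]
  obtain ⟨r, hr⟩ := (ZMod.intCast_eq_intCast_iff_dvd_sub _ _ _).mp h
  refine LAdd_eq_of_sub_int (n := r) ?_
  have hr' : (u : ℚ) - (u : ZMod q).val = q * r := by exact_mod_cast hr
  rw [← sub_div, hr', mul_div_cancel_left₀ _ hq]

section eigenform

variable (hf : IsHeckeCuspForm f)
include hf

/-- For primitive χ, ∑_b χ(b)e(bn/q) = χ̄(n)τ(χ) with τ(χ) ≠ 0, so the character twist inherits its
continuation from the additive twists. -/
lemma isEntireContinuation_charTwist_inv {χ : DirichletCharacter ℂ q} (hχ : χ.IsPrimitive) :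
    IsEntireContinuation (charTwist f χ⁻¹)
      (fun s ↦ ∑ b : ZMod q, (tau χ)⁻¹ * χ b * LAdd f ((b.val : ℚ) / q) s) := by
  have h := isEntireContinuation_sum (Finset.univ : Finset (ZMod q))
    (fun b ↦ (tau χ)⁻¹ * χ b) fun b _ ↦ isEntireContinuation_LAdd hf ((b.val : ℚ) / q)
  have hτ := tau_ne_zero hχ
  convert! h using 1
  funext n
  have h1 := gaussSum_mulShift_of_isPrimitive (e := ZMod.stdAddChar) hχ (n : ZMod q)
  have h2 : ∑ b : ZMod q, (tau χ)⁻¹ * χ b * addTwist f ((b.val : ℚ) / q) n =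
      (tau χ)⁻¹ * heckeEigenvalue f n * gaussSum χ (ZMod.stdAddChar.mulShift (n : ZMod q)) := by
    rw [gaussSum, Finset.mul_sum]
    refine Finset.sum_congr rfl fun b _ ↦ ?_
    rw [addTwist_div, AddChar.mulShift_apply]
    ring
  rw [h2, h1, charTwist, ← tau]
  field_simp

lemma isEntireContinuation_LChar {χ : DirichletCharacter ℂ q} (hχ : χ.IsPrimitive) :
    IsEntireContinuation (charTwist f χ) (LChar f χ) := by
  have h : χ⁻¹.IsPrimitive := by
    rw [isPrimitive_iff_ne_one] at hχ ⊢
    simpa using hχ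
  have := isEntireContinuation_charTwist_inv hf h
  rw [inv_inv] at this
  exact isEntireContinuation_continuedLSeries this

lemma tau_mul_LChar_inv {χ : DirichletCharacter ℂ q} (hχ : χ.IsPrimitive) (s : ℂ) :
    tau χ * LChar f χ⁻¹ s = ∑ b : ZMod q, χ b * LAdd f ((b.val : ℚ) / q) s := by
  have hτ := tau_ne_zero hχ
  have h := isEntireContinuation_charTwist_inv hf hχ
  rw [LChar, (isEntireContinuation_continuedLSeries h).unique h, Finset.mul_sum]
  refine Finset.sum_congr rfl fun b _ ↦ ?_
  field_simp

/-- The relation λ(ql) = λ(q)λ(l) − λ(l/q) is summed over l. By orthogonality this series is the sum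
of all additive twists modulo q. -/
lemma isEntireContinuation_multiples : IsEntireContinuation
    (fun n ↦ if q ∣ n then q * heckeEigenvalue f n else 0)
    (fun s ↦ q * (heckeEigenvalue f q * (q : ℂ) ^ (-s) - (q : ℂ) ^ (-s) * (q : ℂ) ^ (-s)) *
      L f s) := by
  have hq : q.Prime := Fact.out
  have hq' : (q : ℂ) ≠ 0 := by exact_mod_cast hq.ne_zero
  have hL := isEntireContinuation_L hf
  refine ⟨?_, fun s hs ↦ ?_⟩
  · have h1 : Differentiable ℂ fun s : ℂ ↦ (q : ℂ) ^ (-s) :=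
      fun s ↦ (differentiable_neg s).const_cpow (Or.inl hq')
    exact ((((h1.const_mul _).sub (h1.mul h1)).const_mul _)).mul hL.1
  have h0 := hL.2 s hs
  rw [LSeriesHasSum] at h0 ⊢
  have hinj : Function.Injective fun l : ℕ ↦ q * l :=
    fun x y h ↦ Nat.eq_of_mul_eq_mul_left hq.pos h
  have hout (a : ℕ → ℂ) (n : ℕ) (hn : n ∉ Set.range fun l : ℕ ↦ q * l) :
      LSeries.term (fun n ↦ if q ∣ n then a n else 0) s n = 0 := by
    have : ¬q ∣ n := by
      rintro ⟨r, rfl⟩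
      exact hn ⟨r, rfl⟩
    simp [LSeries.term_def, this]
  have hpow (l : ℕ) : ((q * l : ℕ) : ℂ) ^ s = (q : ℂ) ^ s * (l : ℂ) ^ s := by
    rw [Nat.cast_mul, natCast_mul_natCast_cpow]
  have hqs : (q : ℂ) ^ s ≠ 0 := by simp [cpow_eq_zero_iff, hq']
  have h2 : HasSum (LSeries.term (fun n ↦ if q ∣ n then heckeEigenvalue f (n / q) else 0) s)
      ((q : ℂ) ^ (-s) * L f s) := by
    refine (hinj.hasSum_iff (hout _)).mp ?_
    convert! h0.mul_left ((q : ℂ) ^ (-s)) using 1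
    funext l
    rcases Nat.eq_zero_or_pos l with rfl | hl
    · simp
    rw [Function.comp, LSeries.term_of_ne_zero (Nat.mul_pos hq.pos hl).ne',
      LSeries.term_of_ne_zero hl.ne', if_pos (dvd_mul_right q l), Nat.mul_div_cancel_left l hq.pos,
      hpow, cpow_neg]
    field_simp
  refine (hinj.hasSum_iff (hout _)).mp ?_
  convert! ((h0.mul_left (heckeEigenvalue f q)).sub h2).mul_left (q * (q : ℂ) ^ (-s)) using 1
  · funext l
    rcases Nat.eq_zero_or_pos l with rfl | hl
    · simp
    rw [Function.comp, LSeries.term_of_ne_zero (Nat.mul_pos hq.pos hl).ne',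
      LSeries.term_of_ne_zero hl.ne', LSeries.term_of_ne_zero hl.ne', if_pos (dvd_mul_right q l),
      heckeEigenvalue_mul_prime hf hq hl, hpow, cpow_neg]
    field_simp
  · ring

lemma sum_LAdd_div (s : ℂ) : ∑ b : ZMod q, LAdd f ((b.val : ℚ) / q) s =
    q * (heckeEigenvalue f q * (q : ℂ) ^ (-s) - (q : ℂ) ^ (-s) * (q : ℂ) ^ (-s)) * L f s := by
  have h := isEntireContinuation_sum (Finset.univ : Finset (ZMod q))
    (fun _ ↦ 1) fun b _ ↦ isEntireContinuation_LAdd hf ((b.val : ℚ) / q)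
  have hcoeff : (fun n : ℕ ↦ ∑ b : ZMod q, 1 * addTwist f ((b.val : ℚ) / q) n) =
      fun n ↦ if q ∣ n then q * heckeEigenvalue f n else 0 := by
    funext n
    simp only [one_mul, addTwist_div, ← Finset.mul_sum]
    have := AddChar.sum_mulShift (ψ := (ZMod.stdAddChar : AddChar (ZMod q) ℂ)) (n : ZMod q)
      (ZMod.isPrimitive_stdAddChar q)
    simp only [mul_comm _ (n : ZMod q)] at this
    rw [this]
    simp only [ZMod.natCast_eq_zero_iff, ZMod.card]
    split_ifs
    · ring
    · simp
  rw [hcoeff] at h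
  have := congrFun (h.unique (isEntireContinuation_multiples hf)) s
  simpa using this

open Classical in
/-- The twisted moment is the central value of an additive twist. -/
lemma twistedMoment_eq_LAdd {a u : ℤ} (h : (a : ZMod q) * (u : ZMod q) = 1) :
    twistedMoment f a q = LAdd f ((u : ℚ) / q) (1 / 2) := by
  have hq : q.Prime := Fact.out
  have hq' : (q : ℂ) ≠ 0 := by exact_mod_cast hq.ne_zero
  have hφ : (Nat.totient q : ℂ) ≠ 0 := by
    exact_mod_cast (Nat.totient_pos.mpr hq.pos).ne'
  set E : ZMod q → ℂ := fun b ↦ LAdd f ((b.val : ℚ) / q) (1 / 2) with hE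
  have hE0 : E 0 = L f (1 / 2) := by simp [hE, LAdd_zero]
  have hprim : (Finset.univ.filter fun χ : DirichletCharacter ℂ q ↦ χ.IsPrimitive) =
      Finset.univ.erase 1 := by
    ext χ
    simp [isPrimitive_iff_ne_one]
  have hall : ∑ χ : DirichletCharacter ℂ q, (∑ b : ZMod q, χ b * E b) * χ (a : ZMod q) =
      Nat.totient q * E u := by
    simp only [Finset.sum_mul]
    rw [Finset.sum_comm]
    have h1 (b : ZMod q) : ∑ χ : DirichletCharacter ℂ q, χ b * E b * χ (a : ZMod q) =
        E b * if b = u then (Nat.totient q : ℂ) else 0 := by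
      have h2 : (b = u) ↔ b * a = 1 := by
        constructor
        · rintro rfl
          rw [mul_comm, h]
        · intro h3
          calc b = b * (a * u) := by rw [h, mul_one]
            _ = u := by rw [← mul_assoc, h3, one_mul]
      simp only [h2]
      rw [← DirichletCharacter.sum_characters_eq, Finset.mul_sum]
      refine Finset.sum_congr rfl fun χ _ ↦ ?_
      rw [map_mul]
      ring
    simp only [h1, mul_ite, mul_zero, Finset.sum_ite_eq', Finset.mem_univ, if_true]
    ring
  have ha : IsUnit (a : ZMod q) := IsUnit.of_mul_eq_one _ h
  -- The principal character omits b = 0. Together with `hEsum` its contribution is (λ_f(q)√q −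
  -- 2)L(1/2,f), the correction term of the moment.
  have hone : (∑ b : ZMod q, (1 : DirichletCharacter ℂ q) b * E b) *
      (1 : DirichletCharacter ℂ q) (a : ZMod q) = ∑ b : ZMod q, E b - E 0 := by
    rw [MulChar.one_apply ha, mul_one, eq_sub_iff_add_eq, ← Finset.add_sum_erase _ _
      (Finset.mem_univ (0 : ZMod q)), ← Finset.add_sum_erase Finset.univ E
      (Finset.mem_univ (0 : ZMod q)), MulChar.map_zero, zero_mul, zero_add, add_comm]
    congr 1
    refine Finset.sum_congr rfl fun b hb ↦ ?_
    rw [MulChar.one_apply (isUnit_iff_ne_zero.mpr (Finset.ne_of_mem_erase hb)), one_mul]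
  have hsum : ∑ χ : DirichletCharacter ℂ q with χ.IsPrimitive,
      tau χ * LChar f χ⁻¹ (1 / 2) * χ (a : ZMod q) =
      Nat.totient q * E u - (∑ b : ZMod q, E b - E 0) := by
    rw [← hall, ← hone, ← Finset.sum_erase_eq_sub (Finset.mem_univ _), ← hprim]
    refine Finset.sum_congr rfl fun χ hχ ↦ ?_
    rw [tau_mul_LChar_inv hf (Finset.mem_filter.mp hχ).2]
  have hs : ((Real.sqrt (q : ℝ) : ℝ) : ℂ) = (q : ℂ) ^ (1 / 2 : ℂ) := by
    rw [Real.sqrt_eq_rpow, ofReal_cpow (by positivity)]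
    push_cast
    rfl
  have hss : (q : ℂ) ^ (1 / 2 : ℂ) * (q : ℂ) ^ (1 / 2 : ℂ) = q := by
    rw [← cpow_add _ _ hq', add_halves, cpow_one]
  have hs0 : (q : ℂ) ^ (1 / 2 : ℂ) ≠ 0 := by simp [cpow_eq_zero_iff, hq']
  have hEsum : ∑ b : ZMod q, E b =
      (heckeEigenvalue f q * (q : ℂ) ^ (1 / 2 : ℂ) - 1) * L f (1 / 2) := by
    rw [sum_LAdd_div hf, cpow_neg]
    generalize (q : ℂ) ^ (1 / 2 : ℂ) = r at *
    rw [← hss]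
    field_simp
  rw [twistedMoment, LAdd_intCast_div]
  change 1 / (Nat.totient q : ℂ) * (_ + _) = E u
  rw [hsum, hEsum, hE0, hs]
  field_simp
  ring

end eigenform

end prime

/-! ### Assembling the reciprocity formula -/

section assembly

variable (hf : IsHeckeCuspForm f)
include hf

/-- Here (k−1)/2 = m + 1/2, so the Mellin argument m + j + 1 corresponds to the point 1/2 + j. -/
lemma mellin_vertical_nat {m : ℕ} (hk : k = 2 * m + 2) (x : ℚ) (j : ℕ) :
    mellin (vertical f x) ((m + j : ℕ) + 1) =
      fourierCoefficient f 1 * ((2 * Real.pi : ℂ) ^ (m + j + 1))⁻¹ * ((m + j).factorial : ℂ) *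
        LAdd f x (1 / 2 + j) := by
  have hre : 0 < (((m + j : ℕ) : ℂ) + 1).re := by
    simp only [add_re, natCast_re, one_re]
    positivity
  have hpow : (2 * Real.pi : ℂ) ^ (((m + j : ℕ) : ℂ) + 1) = (2 * Real.pi : ℂ) ^ (m + j + 1) := by
    rw [← cpow_natCast]
    push_cast
    rfl
  rw [mellin_vertical_eq hf x hre, Gamma_nat_eq_factorial, cpow_neg, hpow]
  congr 2
  rw [hk]
  push_cast
  ring

/-- After division by `I ^ m * c`, the j = 0 part of the three-term relation is L(1/2,f) − (−1)^m
L(1/2, f⊗e(y)). The two-term relation turns its second summand into the value at x'. -/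
lemma LAdd_sub_LAdd {m : ℕ} (hk : k = 2 * m + 2) {p q u v : ℤ} (h : p * u + q * v = 1)
    (hp : 0 < p) (hq : 0 < q) {x x' y : ℚ} (hx : x = u / q) (hx' : x' = -v / p) (hy : y = q / p) :
    LAdd f x (1 / 2) - LAdd f x' (1 / 2) = L f (1 / 2) +
      ∑ j ∈ Finset.Icc 1 m, 1 / (j.factorial : ℂ) * (((m + j).factorial : ℂ) / (m - j).factorial) *
        (2 * (Real.pi : ℂ) * I * y) ^ (-(j : ℤ)) *
        (L f (1 / 2 + j) + (-1) ^ j * I ^ k * LAdd f y (1 / 2 + j)) := by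
  have ha := fourierCoefficient_one_ne_zero hf
  have hpi : (2 * Real.pi : ℂ) ≠ 0 := by simp [Real.pi_ne_zero]
  have hp' : (p : ℂ) ≠ 0 := by exact_mod_cast hp.ne'
  have hq' : (q : ℂ) ≠ 0 := by exact_mod_cast hq.ne'
  have hyC : (y : ℂ) = q / p := by rw [hy]; push_cast; rfl
  have hy0 : (y : ℂ) ≠ 0 := by rw [hyC]; exact div_ne_zero hq' hp'
  have h3 := mellin_three_term f hk h hp hq hx hy
  have h2 := mellin_two_term f hk h hp hx' hy
  have hcent (z : ℚ) : mellin (vertical f z) (m + 1) = fourierCoefficient f 1 *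
      ((2 * Real.pi : ℂ) ^ (m + 1))⁻¹ * (m.factorial : ℂ) * LAdd f z (1 / 2) := by
    simpa using mellin_vertical_nat hf hk z 0
  rw [hcent, hcent] at h2
  rw [hcent] at h3
  simp only [mellin_vertical_nat hf hk, LAdd_zero] at h3
  set c : ℂ := fourierCoefficient f 1 * ((2 * Real.pi : ℂ) ^ (m + 1))⁻¹ * (m.factorial : ℂ) with hc
  have hmf : (m.factorial : ℂ) ≠ 0 := by exact_mod_cast m.factorial_ne_zero
  have hc0 : c ≠ 0 := mul_ne_zero (mul_ne_zero ha (inv_ne_zero (pow_ne_zero _ hpi))) hmf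
  have hIm : I ^ m ≠ 0 := pow_ne_zero _ I_ne_zero
  have hsq : ((-1 : ℂ) ^ m) * (-1) ^ m = 1 := by rw [← mul_pow]; norm_num
  have hIk : I ^ k = -(-1) ^ m := by
    rw [hk, pow_add, pow_mul, I_sq]
    ring
  rw [← Finset.sum_sub_distrib, Finset.sum_range_succ'] at h3
  -- The factorials match because C(m,j)(m+j)!/m! = (m+j)!/(j!(m−j)!), and the signs because i^k =
  -- −(−1)^m and 1/i = −i.
  have hterm (j : ℕ) (hj : j ≤ m) :
      m.choose j * (-(y⁻¹ : ℂ)) ^ j * I ^ (m + j) * (fourierCoefficient f 1 *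
        ((2 * Real.pi : ℂ) ^ (m + j + 1))⁻¹ * ((m + j).factorial : ℂ) * L f (1 / 2 + j)) -
      m.choose j * (-1) ^ m * (y⁻¹ : ℂ) ^ j * I ^ (m + j) * (fourierCoefficient f 1 *
        ((2 * Real.pi : ℂ) ^ (m + j + 1))⁻¹ * ((m + j).factorial : ℂ) * LAdd f y (1 / 2 + j)) =
      I ^ m * c * (1 / (j.factorial : ℂ) * (((m + j).factorial : ℂ) / (m - j).factorial) *
        (2 * (Real.pi : ℂ) * I * y) ^ (-(j : ℤ)) *
        (L f (1 / 2 + j) + (-1) ^ j * I ^ k * LAdd f y (1 / 2 + j))) := by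
    have hch : (m.choose j : ℂ) * j.factorial * (m - j).factorial = m.factorial := by
      exact_mod_cast Nat.choose_mul_factorial_mul_factorial hj
    have hjf : (j.factorial : ℂ) ≠ 0 := by exact_mod_cast j.factorial_ne_zero
    have hmjf : ((m - j).factorial : ℂ) ≠ 0 := by exact_mod_cast (m - j).factorial_ne_zero
    have hz : (2 * (Real.pi : ℂ) * I * y) ^ (-(j : ℤ)) =
        (-1) ^ j * I ^ j * ((2 * Real.pi : ℂ) ^ j)⁻¹ * (y⁻¹ : ℂ) ^ j := by
      rw [zpow_neg, zpow_natCast, mul_pow, mul_pow, mul_inv, mul_inv, ← inv_pow I, inv_I,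
        neg_pow I, inv_pow (y : ℂ)]
      ring
    have hneg : (-1 : ℂ) ^ j * (-1) ^ j = 1 := by rw [← mul_pow]; norm_num
    have hP : ((2 * Real.pi : ℂ) ^ (m + j + 1))⁻¹ =
        ((2 * Real.pi : ℂ) ^ (m + 1))⁻¹ * ((2 * Real.pi : ℂ) ^ j)⁻¹ := by
      rw [← mul_inv, ← pow_add]
      ring_nf
    rw [hz, hc, ← hch, hIk, hP, neg_pow (y⁻¹ : ℂ), pow_add I]
    generalize LAdd f y (1 / 2 + j) = B
    generalize L f (1 / 2 + j) = A
    field_simp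
    linear_combination (m.choose j : ℂ) * (m + j).factorial * (-1) ^ m * B * hneg
  have hsum : ∑ j ∈ Finset.Icc 1 m, 1 / (j.factorial : ℂ) *
      (((m + j).factorial : ℂ) / (m - j).factorial) * (2 * (Real.pi : ℂ) * I * y) ^ (-(j : ℤ)) *
        (L f (1 / 2 + j) + (-1) ^ j * I ^ k * LAdd f y (1 / 2 + j)) =
      ∑ i ∈ Finset.range m, 1 / ((i + 1).factorial : ℂ) *
        (((m + (i + 1)).factorial : ℂ) / (m - (i + 1)).factorial) *
        (2 * (Real.pi : ℂ) * I * y) ^ (-((i + 1 : ℕ) : ℤ)) *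
        (L f (1 / 2 + (i + 1 : ℕ)) + (-1) ^ (i + 1) * I ^ k * LAdd f y (1 / 2 + (i + 1 : ℕ))) := by
    rw [Finset.range_eq_Ico, Finset.sum_Ico_add' (fun j : ℕ ↦ 1 / (j.factorial : ℂ) *
      (((m + j).factorial : ℂ) / (m - j).factorial) * (2 * (Real.pi : ℂ) * I * y) ^ (-(j : ℤ)) *
        (L f (1 / 2 + j) + (-1) ^ j * I ^ k * LAdd f y (1 / 2 + j)))]
    rfl
  have hzero : 1 / (Nat.factorial 0 : ℂ) * (((m + 0).factorial : ℂ) / (m - 0).factorial) *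
      (2 * (Real.pi : ℂ) * I * y) ^ (-((0 : ℕ) : ℤ)) *
      (L f (1 / 2 + (0 : ℕ)) + (-1) ^ 0 * I ^ k * LAdd f y (1 / 2 + (0 : ℕ))) =
      L f (1 / 2) - (-1) ^ m * LAdd f y (1 / 2) := by
    simp [hmf, hIk, sub_eq_add_neg]
  rw [hterm 0 (Nat.zero_le m), hzero,
    Finset.sum_congr rfl fun i hi ↦ hterm (i + 1) (Finset.mem_range.mp hi),
    ← Finset.mul_sum, ← hsum] at h3
  apply mul_left_cancel₀ (mul_ne_zero hIm hc0)
  linear_combination h3 - I ^ m * (-1) ^ m * h2 + I ^ m * c * LAdd f x' (1 / 2) * hsq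

end assembly

end

end HeckeReciprocity

theorem corollary1 (k : ℕ) (hk : 12 ≤ k) (f : CuspForm 𝒮ℒ (k : ℤ))
    (hf : HeckeReciprocity.IsHeckeCuspForm f)
    (p q : ℕ) [Fact p.Prime] [Fact q.Prime] (hp : Odd p) (hq : Odd q) (hpq : p ≠ q) :
    -- all `L`-functions occurring in the formula are entire continuations of their series
    HeckeReciprocity.IsEntireContinuation (HeckeReciprocity.heckeEigenvalue f)
        (HeckeReciprocity.L f) ∧
    (∀ α : ℚ, HeckeReciprocity.IsEntireContinuation (HeckeReciprocity.addTwist f α)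
        (HeckeReciprocity.LAdd f α)) ∧
    (∀ χ : DirichletCharacter ℂ q, χ.IsPrimitive →
      HeckeReciprocity.IsEntireContinuation (HeckeReciprocity.charTwist f χ)
        (HeckeReciprocity.LChar f χ)) ∧
    (∀ χ : DirichletCharacter ℂ p, χ.IsPrimitive →
      HeckeReciprocity.IsEntireContinuation (HeckeReciprocity.charTwist f χ)
        (HeckeReciprocity.LChar f χ)) ∧
    -- the reciprocity relation
    HeckeReciprocity.twistedMoment f (p : ℤ) q - HeckeReciprocity.twistedMoment f (-(q : ℤ)) p =
      HeckeReciprocity.L f (1 / 2) +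
        ∑ j ∈ Finset.Icc 1 (k / 2 - 1),
          1 / (Nat.factorial j : ℂ) *
            (Complex.Gamma ((k : ℂ) / 2 + (j : ℂ)) / Complex.Gamma ((k : ℂ) / 2 - (j : ℂ))) *
            (2 * (Real.pi : ℂ) * Complex.I * (q : ℂ) / (p : ℂ)) ^ (-(j : ℤ)) *
            (HeckeReciprocity.L f (1 / 2 + (j : ℂ)) +
              (-1) ^ j * Complex.I ^ k *
                HeckeReciprocity.LAdd f ((q : ℚ) / (p : ℚ)) (1 / 2 + (j : ℂ))) := by
  open HeckeReciprocity in
  refine ⟨isEntireContinuation_L hf, isEntireContinuation_LAdd hf,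
    fun χ hχ ↦ isEntireContinuation_LChar hf hχ, fun χ hχ ↦ isEntireContinuation_LChar hf hχ, ?_⟩
  have hp' : p.Prime := Fact.out
  have hq' : q.Prime := Fact.out
  obtain ⟨r, hr⟩ := even_weight f hf.1
  obtain ⟨m, rfl⟩ : ∃ m, r = m + 1 := ⟨r - 1, by omega⟩
  have hkm : k = 2 * m + 2 := by omega
  -- The Bézout identity makes u the inverse of p modulo q and −v the inverse of −q modulo p.
  obtain ⟨u, v, huv⟩ := Int.isCoprime_iff_gcd_eq_one.mpr
    (by simpa using (Nat.coprime_primes hp' hq').mpr hpq : Int.gcd (p : ℤ) (q : ℤ) = 1)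
  have h1 : (((p : ℤ) : ZMod q)) * (u : ZMod q) = 1 := by
    have := congrArg (Int.cast : ℤ → ZMod q) huv
    push_cast at this ⊢
    simpa [mul_comm] using this
  have h2 : ((-(q : ℤ) : ℤ) : ZMod p) * ((-v : ℤ) : ZMod p) = 1 := by
    have := congrArg (Int.cast : ℤ → ZMod p) huv
    push_cast at this ⊢
    simpa [mul_comm] using this
  rw [twistedMoment_eq_LAdd hf h1, twistedMoment_eq_LAdd hf h2,
    LAdd_sub_LAdd hf hkm (p := p) (q := q) (u := u) (v := v) (y := (q : ℚ) / p)
      (by linear_combination huv) (by exact_mod_cast hp'.pos) (by exact_mod_cast hq'.pos)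
      (by push_cast; rfl) (by push_cast; rfl) (by push_cast; rfl),
    show k / 2 - 1 = m by omega]
  congr 1
  refine Finset.sum_congr rfl fun j hj ↦ ?_
  have hj := (Finset.mem_Icc.mp hj).2
  have hG1 : Gamma ((k : ℂ) / 2 + j) = (m + j).factorial := by
    rw [← Gamma_nat_eq_factorial, hkm]
    congr 1
    push_cast
    ring
  -- As j ≤ m, the argument m − j + 1 is a positive integer.
  have hG2 : Gamma ((k : ℂ) / 2 - j) = (m - j).factorial := by
    rw [← Gamma_nat_eq_factorial, hkm, Nat.cast_sub hj]
    congr 1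
    push_cast
    ring
  rw [hG1, hG2]
  congr 3
  push_cast
  ring
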